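/- Fix $\alpha\in\mathbb R$ and $c\ge 0$, and let $S^1=\mathbb R/2\pi\mathbb Z$. On $\mathbb R_+\times S^1$, where $\mathbb R_+=(0,\infty)$, with coordinates $(x,y)$, consider the Riemannian metric for which $$X_1=\frac{\partial}{\partial x},\qquad X_2^{(\alpha)}=x^\alpha\frac{\partial}{\partial y}$$ is an orthonormal frame; its Riemannian area is $x^{-\alpha}\,dx\,dy$. Let $\Delta_\alpha=\operatorname{div}\circ\operatorname{grad}$ be its Laplace–Beltrami operator (the divergence being taken with respect to the Riemannian area) and $K_\alpha$ its Gaussian curvature. Let $-\Delta_\alpha+cK_\alpha$ be the curvature Laplacian with domain $C_0^\infty(\mathbb R_+\times S^1)$ (smooth complex-valued functions with compact support) acting on the complex Hilbert space $L^2(\mathbb R_+\times S^1,\,x^{-\alpha}\,dx\,dy)$. It is called essentially self-adjoint if its closure is self-adjoint. For $c\neq\frac14$ with $(c-2+\sqrt3)(c-2-\sqrt3)\ge 0$ put $$\alpha_{c,\pm}=\frac{(-2c+1)\pm2\sqrt{(c-2+\sqrt3)(c-2-\sqrt3)}}{4c-1}.$$ Then: - if $0\le c<\frac14$, then $-\Delta_\alpha+cK_\alpha$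 is essentially self-adjoint if and only if $\alpha\le\alpha_{c,+}$ or $\alpha\ge\alpha_{c,-}$ (here $\alpha_{c,+}<\alpha_{c,-}$, because $4c-1<0$); - if $c=\frac14$, then $-\Delta_\alpha+cK_\alpha$ is essentially self-adjoint if and only if $\alpha\ge3$; - if $\frac14<c\le2-\sqrt3$, then $-\Delta_\alpha+cK_\alpha$ is essentially self-adjoint if and only if $\alpha_{c,-}\le\alpha\le\alpha_{c,+}$; - if $2-\sqrt3<c<2+\sqrt3$, then $-\Delta_\alpha+cK_\alpha$ is not essentially self-adjoint, for any $\alpha\in\mathbb R$; - if $c\ge2+\sqrt3$, then $-\Delta_\alpha+cK_\alpha$ is essentially self-adjoint if and only if $\alpha_{c,-}\le\alpha\le\alpha_{c,+}$. In particular, for $\alpha=1$ and $c\ge0$ the operator $-\Delta_1+cK_1$ is essentially self-adjoint if and only if $c=0$. -/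

import Mathlib

open MeasureTheory Set Filter Topology
open scoped ContDiff

noncomputable section

namespace GrushinCylinder

instance factTwoPiPos : Fact (0 < 2 * Real.pi) := ⟨Real.two_pi_pos⟩

/-- The cylinder `ℝ × S¹`, with `S¹ = ℝ / 2πℤ`. -/
abbrev Cyl : Type := ℝ × AddCircle (2 * Real.pi)

/-- The open half-cylinder `ℝ₊ × S¹`. -/
def halfCyl : Set Cyl := {p | 0 < p.1}

/-! ### Differential calculus in the coordinates `(x, y)` -/

/-- The flows of the two coordinate vector fields: `coordShift 0 t = (t, 0)` and
`coordShift 1 t = (0, t mod 2π)`. -/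
def coordShift (i : Fin 2) (t : ℝ) : Cyl :=
  if i = 0 then (t, 0) else (0, (t : AddCircle (2 * Real.pi)))

/-- The partial derivatives on the cylinder: `pd 0 = ∂/∂x` and `pd 1 = ∂/∂y`. -/
def pd {E : Type*} [NormedAddCommGroup E] [NormedSpace ℝ E]
    (i : Fin 2) (u : Cyl → E) (p : Cyl) : E :=
  deriv (fun t : ℝ => u (p + coordShift i t)) 0

/-- A vector field, in the coordinates `(x, y)`. -/
abbrev VField : Type := Cyl → Fin 2 → ℝ

/-- A field of symmetric matrices `(g_{ij})`, in the coordinates `(x, y)`. -/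
abbrev MetricField : Type := Cyl → Matrix (Fin 2) (Fin 2) ℝ

/-- The metric for which the frame `(X 0, X 1)` is orthonormal (where the frame is linearly
independent): its inverse is `∑ a, X a ⊗ X a`. -/
def frameMetric (X : Fin 2 → VField) : MetricField :=
  fun p => (Matrix.of fun i j => ∑ a, X a p i * X a p j)⁻¹

/-- The Riemannian area density `√(det g)` with respect to `dx dy`. -/
def areaDensity (g : MetricField) (p : Cyl) : ℝ := Real.sqrt (g p).det

/-- The components `∑ j, g^{ij} ∂_j u` of the Riemannian gradient. -/
def gradient (g : MetricField) (u : Cyl → ℂ) (i : Fin 2) (p : Cyl) : ℂ :=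
  ∑ j, (g p)⁻¹ i j • pd j u p

/-- The divergence with respect to the Riemannian area. -/
def divergence (g : MetricField) (Y : Fin 2 → Cyl → ℂ) (p : Cyl) : ℂ :=
  (areaDensity g p)⁻¹ • ∑ i, pd i (fun q => areaDensity g q • Y i q) p

/-- The Laplace-Beltrami operator `div ∘ grad`. -/
def laplaceBeltrami (g : MetricField) (u : Cyl → ℂ) : Cyl → ℂ :=
  divergence g (gradient g u)

/-- The Christoffel symbols `Γ^k_{ij}` of the Levi-Civita connection. -/
def christoffel (g : MetricField) (k i j : Fin 2) (p : Cyl) : ℝ :=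
  (1 / 2) * ∑ l, (g p)⁻¹ k l *
    (pd i (fun q => g q j l) p + pd j (fun q => g q i l) p - pd l (fun q => g q i j) p)

/-- The curvature components: `R(∂_i, ∂_j) ∂_k = ∑ l, riemann g l k i j • ∂_l`, where
`R(X, Y) = ∇_X ∇_Y - ∇_Y ∇_X - ∇_[X, Y]`. -/
def riemann (g : MetricField) (l k i j : Fin 2) (p : Cyl) : ℝ :=
  pd i (christoffel g l j k) p - pd j (christoffel g l i k) p
    + ∑ m, (christoffel g l i m p * christoffel g m j k p
      - christoffel g l j m p * christoffel g m i k p)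

/-- The Gaussian curvature `g(R(∂_x, ∂_y) ∂_y, ∂_x) / det g`. -/
def gaussCurvature (g : MetricField) (p : Cyl) : ℝ :=
  (∑ l, g p 0 l * riemann g l 1 0 1 p) / (g p).det

/-- The expression `-Δ u + c K u`. -/
def curvatureExpr (g : MetricField) (c : ℝ) (u : Cyl → ℂ) (p : Cyl) : ℂ :=
  -laplaceBeltrami g u p + (c * gaussCurvature g p) • u p

/-! ### The `α`-Grushin structure -/

/-- The frame `X 0 = ∂/∂x`, `X 1 = x^α ∂/∂y`. -/
def grushinFrame (α : ℝ) : Fin 2 → VField :=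
  ![fun _ => ![1, 0], fun p => ![0, p.1 ^ α]]

/-- The Riemannian metric on `ℝ₊ × S¹` with orthonormal frame `∂/∂x`, `x^α ∂/∂y`. -/
def grushinMetric (α : ℝ) : MetricField := frameMetric (grushinFrame α)

/-- The measure `x^{-α} dx dy` on `ℝ₊ × S¹`. -/
def grushinMeasure (α : ℝ) : Measure Cyl :=
  (volume.restrict halfCyl).withDensity fun p => ENNReal.ofReal (p.1 ^ (-α))

/-! ### Test functions -/

/-- A function on the cylinder read on the universal cover `ℝ × ℝ`. -/
def lift {E : Type*} (u : Cyl → E) (q : ℝ × ℝ) : E :=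
  u (q.1, (q.2 : AddCircle (2 * Real.pi)))

/-- `C₀^∞(ℝ₊ × S¹)`: the functions on `ℝ × S¹` that are smooth (i.e. smooth on the universal
cover) and whose support is a compact subset of `ℝ₊ × S¹`. -/
def testFunctions : Submodule ℂ (Cyl → ℂ) where
  carrier := {u | ContDiff ℝ ∞ (lift u) ∧ HasCompactSupport u ∧ tsupport u ⊆ halfCyl}
  zero_mem' := by
    refine ⟨contDiff_const, HasCompactSupport.zero, ?_⟩
    rw [tsupport_eq_empty_iff.2 rfl]
    exact empty_subset _
  add_mem' := fun {u v} hu hv =>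
    ⟨hu.1.add hv.1, hu.2.1.add hv.2.1,
      (tsupport_add u v).trans (union_subset hu.2.2 hv.2.2)⟩
  smul_mem' := fun z u hu =>
    ⟨contDiff_const.smul hu.1, hu.2.1.smul_left (f := fun _ => z),
      (tsupport_smul_subset_right (fun _ => z) u).trans hu.2.2⟩

/-! ### Facts needed to make `-Δ_α + c K_α` a partially defined operator on `L²` -/

theorem isOpen_halfCyl : IsOpen halfCyl := isOpen_lt continuous_const continuous_fst

theorem isOpenQuotientMap_cover : IsOpenQuotientMap
    (fun q : ℝ × ℝ => ((q.1, (q.2 : AddCircle (2 * Real.pi))) : Cyl)) :=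
  IsOpenQuotientMap.id.prodMap QuotientAddGroup.isOpenQuotientMap_mk

theorem continuous_of_lift {E : Type*} [TopologicalSpace E] {u : Cyl → E}
    (h : Continuous (lift u)) : Continuous u :=
  isOpenQuotientMap_cover.isQuotientMap.continuous_iff.2 h

theorem testFunctions_continuous {u : Cyl → ℂ} (hu : u ∈ testFunctions) : Continuous u :=
  continuous_of_lift hu.1.continuous

theorem continuous_coordShift (i : Fin 2) : Continuous (coordShift i) := by
  unfold coordShift
  split_ifs
  · fun_prop
  · exact continuous_const.prodMk (AddCircle.continuous_mk' _)

theorem coordShift_zero (i : Fin 2) : coordShift i 0 = 0 := by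
  unfold coordShift
  split_ifs <;> simp

theorem tendsto_add_coordShift (i : Fin 2) (p : Cyl) :
    Tendsto (fun t => p + coordShift i t) (𝓝 0) (𝓝 p) := by
  have h : Continuous fun t => p + coordShift i t :=
    continuous_const.add (continuous_coordShift i)
  simpa [coordShift_zero] using h.tendsto 0

theorem pd_congr {E : Type*} [NormedAddCommGroup E] [NormedSpace ℝ E] (i : Fin 2)
    {u v : Cyl → E} {p : Cyl} (h : u =ᶠ[𝓝 p] v) : pd i u p = pd i v p :=
  Filter.EventuallyEq.deriv_eq ((tendsto_add_coordShift i p).eventually h)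

theorem pd_zero_apply {E : Type*} [NormedAddCommGroup E] [NormedSpace ℝ E]
    (u : Cyl → E) (x : ℝ) (y : AddCircle (2 * Real.pi)) :
    pd 0 u (x, y) = deriv (fun s => u (s, y)) x := by
  have := deriv_comp_const_add (f := fun s => u (s, y)) x 0
  simpa [pd, coordShift] using this

theorem pd_one_of_fst {E : Type*} [NormedAddCommGroup E] [NormedSpace ℝ E]
    (f : ℝ → E) (p : Cyl) : pd 1 (fun q => f q.1) p = 0 := by
  simp [pd, coordShift]

theorem lift_pd {E : Type*} [NormedAddCommGroup E] [NormedSpace ℝ E] (i : Fin 2)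
    {u : Cyl → E} {q : ℝ × ℝ} (h : DifferentiableAt ℝ (lift u) q) :
    lift (pd i u) q = fderiv ℝ (lift u) q (if i = 0 then (1, 0) else (0, 1)) := by
  rw [← h.lineDeriv_eq_fderiv]
  unfold lift pd lineDeriv coordShift
  split_ifs <;> simp

theorem pd_mem (i : Fin 2) {u : Cyl → ℂ} (hu : u ∈ testFunctions) : pd i u ∈ testFunctions := by
  have hs : Function.support (pd i u) ⊆ tsupport u := by
    intro p hp
    by_contra hn
    apply hp
    have : u =ᶠ[𝓝 p] fun _ => 0 := notMem_tsupport_iff_eventuallyEq.1 hn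
    rw [pd_congr i this]
    simp [pd]
  refine ⟨?_, hu.2.1.mono' hs, (closure_minimal hs (isClosed_tsupport u)).trans hu.2.2⟩
  have : lift (pd i u) =
      fun q => fderiv ℝ (lift u) q (if i = 0 then (1, 0) else (0, 1)) := by
    funext q
    exact lift_pd i (hu.1.differentiable (by simp) q)
  rw [this]
  exact (hu.1.fderiv_right (m := ∞) (by simp)).clm_apply contDiff_const

theorem mul_mem {a : ℝ → ℝ} (ha : ContDiffOn ℝ ∞ a (Ioi 0)) {u : Cyl → ℂ}
    (hu : u ∈ testFunctions) : (fun p => a p.1 • u p) ∈ testFunctions := by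
  have hs : Function.support (fun p : Cyl => a p.1 • u p) ⊆ tsupport u := fun p hp =>
    subset_tsupport u fun h => hp (by simp [h])
  refine ⟨?_, hu.2.1.mono' hs, (closure_minimal hs (isClosed_tsupport u)).trans hu.2.2⟩
  rw [contDiff_iff_contDiffAt]
  intro q
  by_cases hq : 0 < q.1
  · have h1 : ContDiffAt ℝ ∞ (fun q : ℝ × ℝ => a q.1) q :=
      (ha.contDiffAt (Ioi_mem_nhds hq)).comp q contDiffAt_fst
    exact h1.smul hu.1.contDiffAt
  · have hn : ((q.1, (q.2 : AddCircle (2 * Real.pi))) : Cyl) ∉ tsupport u := fun h =>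
      hq (hu.2.2 h)
    have h0 := notMem_tsupport_iff_eventuallyEq.1 hn
    have h1 := isOpenQuotientMap_cover.continuous.continuousAt.eventually h0
    refine (contDiffAt_const (c := (0 : ℂ))).congr_of_eventuallyEq ?_
    filter_upwards [h1] with r hr
    simp only [lift]
    rw [hr]
    simp

theorem pd_add (i : Fin 2) {u v : Cyl → ℂ} (hu : u ∈ testFunctions) (hv : v ∈ testFunctions) :
    pd i (u + v) = pd i u + pd i v := by
  funext p
  obtain ⟨q, rfl⟩ := isOpenQuotientMap_cover.surjective p
  have hdu := hu.1.differentiable (by simp) q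
  have hdv := hv.1.differentiable (by simp) q
  have h := lift_pd i (u := u + v) (hdu.add hdv)
  have h2 : fderiv ℝ (lift (u + v)) q = fderiv ℝ (lift u) q + fderiv ℝ (lift v) q :=
    fderiv_add hdu hdv
  rw [h2, _root_.add_apply, ← lift_pd i hdu, ← lift_pd i hdv] at h
  exact h

theorem pd_smul (i : Fin 2) (z : ℂ) (u : Cyl → ℂ) : pd i (z • u) = z • pd i u := by
  funext p
  simp only [pd, Pi.smul_apply]
  exact deriv_const_smul_field z _

theorem grushinMetric_inv {α : ℝ} {p : Cyl} (hp : p ∈ halfCyl) :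
    (grushinMetric α p)⁻¹ = !![1, 0; 0, p.1 ^ (2 * α)] := by
  have hx : 0 < p.1 := hp
  have h : (Matrix.of fun i j => ∑ a, grushinFrame α a p i * grushinFrame α a p j)
      = !![1, 0; 0, p.1 ^ (2 * α)] := by
    ext i j
    fin_cases i <;> fin_cases j <;>
      simp [grushinFrame, two_mul, Real.rpow_add hx]
  unfold grushinMetric frameMetric
  rw [h, Matrix.nonsing_inv_nonsing_inv]
  simpa [Matrix.det_fin_two] using (Real.rpow_pos_of_pos hx _).ne'

theorem grushinMetric_eq {α : ℝ} {p : Cyl} (hp : p ∈ halfCyl) :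
    grushinMetric α p = !![1, 0; 0, p.1 ^ (-(2 * α))] := by
  have hx : 0 < p.1 := hp
  have hu : IsUnit (Matrix.det !![(1 : ℝ), 0; 0, p.1 ^ (2 * α)]) := by
    simpa [Matrix.det_fin_two] using (Real.rpow_pos_of_pos hx _).ne'
  have h := grushinMetric_inv (α := α) hp
  have h2 : !![(1 : ℝ), 0; 0, p.1 ^ (-(2 * α))] * !![1, 0; 0, p.1 ^ (2 * α)] = 1 := by
    rw [Matrix.mul_fin_two, Matrix.one_fin_two]
    simp [← Real.rpow_add hx]
  rw [← Matrix.inv_eq_left_inv h2, ← h, Matrix.nonsing_inv_nonsing_inv]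
  by_contra hd
  rw [Matrix.nonsing_inv_apply_not_isUnit _ hd] at h
  have := congrFun (congrFun h 0) 0
  simp at this

theorem areaDensity_grushinMetric {α : ℝ} {p : Cyl} (hp : p ∈ halfCyl) :
    areaDensity (grushinMetric α) p = p.1 ^ (-α) := by
  have hx : 0 < p.1 := hp
  rw [areaDensity, grushinMetric_eq hp, Matrix.det_fin_two]
  simp only [Matrix.of_apply, Matrix.cons_val', Matrix.cons_val_zero, Matrix.cons_val_one,
    Matrix.cons_val_fin_one, one_mul, mul_zero, sub_zero]
  rw [show -(2 * α) = -α + -α by ring, Real.rpow_add hx,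
    Real.sqrt_mul_self (Real.rpow_nonneg hx.le _)]

theorem pd_zero_rpow {p : Cyl} (hp : p ∈ halfCyl) (b s : ℝ) :
    pd 0 (fun q : Cyl => b * q.1 ^ s) p = b * (s * p.1 ^ (s - 1)) := by
  obtain ⟨x, y⟩ := p
  have hx : 0 < x := hp
  rw [pd_zero_apply]
  exact ((Real.hasDerivAt_rpow_const (Or.inl hx.ne')).const_mul b).deriv

/-- The partial derivatives of the coefficients of the metric. -/
theorem pd_grushinMetric {α : ℝ} {p : Cyl} (hp : p ∈ halfCyl) (k i j : Fin 2) :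
    pd k (fun q => grushinMetric α q i j) p =
      if k = 0 ∧ i = 1 ∧ j = 1 then -(2 * α) * p.1 ^ (-(2 * α) - 1) else 0 := by
  have h : (fun q => grushinMetric α q i j) =ᶠ[𝓝 p]
      fun q => (!![1, 0; 0, q.1 ^ (-(2 * α))] : Matrix (Fin 2) (Fin 2) ℝ) i j := by
    filter_upwards [isOpen_halfCyl.mem_nhds hp] with q hq
    rw [grushinMetric_eq hq]
  rw [pd_congr k h]
  fin_cases k
  · have h0 := pd_zero_rpow hp 1 (-(2 * α))
    simp only [one_mul] at h0
    fin_cases i <;> fin_cases j <;> simp [h0] <;> simp [pd]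
  · have h1 := pd_one_of_fst
      (fun x => (!![1, 0; 0, x ^ (-(2 * α))] : Matrix (Fin 2) (Fin 2) ℝ) i j) p
    simpa using h1

theorem christoffel_grushinMetric {α : ℝ} {p : Cyl} (hp : p ∈ halfCyl) (k i j : Fin 2) :
    christoffel (grushinMetric α) k i j p =
      if k = 0 then (if i = 1 ∧ j = 1 then α * p.1 ^ (-(2 * α) - 1) else 0)
      else (if i = j then 0 else -α * p.1 ^ (-1 : ℝ)) := by
  have hx : 0 < p.1 := hp
  have e : p.1 ^ (2 * α) * p.1 ^ (-(2 * α) - 1) = p.1 ^ (-1 : ℝ) := by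
    rw [← Real.rpow_add hx]; congr 1; ring
  unfold christoffel
  simp only [Fin.sum_univ_two, grushinMetric_inv hp, pd_grushinMetric hp]
  fin_cases k <;> fin_cases i <;> fin_cases j <;> simp
  all_goals first | (rw [← e]; ring1) | ring1

theorem pd_christoffel {α : ℝ} {p : Cyl} (hp : p ∈ halfCyl) :
    pd 0 (christoffel (grushinMetric α) 0 1 1) p
      = α * ((-(2 * α) - 1) * p.1 ^ (-(2 * α) - 1 - 1)) ∧
    pd 1 (christoffel (grushinMetric α) 0 0 1) p = 0 := by
  constructor
  · rw [← pd_zero_rpow hp]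
    apply pd_congr
    filter_upwards [isOpen_halfCyl.mem_nhds hp] with q hq
    simp [christoffel_grushinMetric hq]
  · rw [← pd_one_of_fst (fun _ => (0 : ℝ)) p]
    apply pd_congr
    filter_upwards [isOpen_halfCyl.mem_nhds hp] with q hq
    simp [christoffel_grushinMetric hq]

theorem gaussCurvature_grushinMetric {α : ℝ} {p : Cyl} (hp : p ∈ halfCyl) :
    gaussCurvature (grushinMetric α) p = -(α * (α + 1)) / p.1 ^ 2 := by
  have hx : 0 < p.1 := hp
  have hr := Real.rpow_pos_of_pos hx (-(2 * α))
  unfold gaussCurvature riemann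
  simp only [Fin.sum_univ_two, (pd_christoffel hp).1, (pd_christoffel hp).2,
    christoffel_grushinMetric hp]
  rw [grushinMetric_eq hp, Matrix.det_fin_two]
  simp [Real.rpow_sub hx, Real.rpow_neg_one]
  field_simp
  ring

/-- On `C₀^∞(ℝ₊ × S¹)` the Laplace-Beltrami operator is
`∂²/∂x² + x^{2α} ∂²/∂y² - (α/x) ∂/∂x`. -/
theorem laplaceBeltrami_grushinMetric {α : ℝ} {u : Cyl → ℂ} (hu : u ∈ testFunctions)
    {p : Cyl} (hp : p ∈ halfCyl) :
    laplaceBeltrami (grushinMetric α) u p =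
      pd 0 (pd 0 u) p + p.1 ^ (2 * α) • pd 1 (pd 1 u) p - (α / p.1) • pd 0 u p := by
  have hx : 0 < p.1 := hp
  have h0 : pd 0 (fun q => areaDensity (grushinMetric α) q • gradient (grushinMetric α) u 0 q) p
      = pd 0 (fun q => q.1 ^ (-α) • pd 0 u q) p := by
    apply pd_congr
    filter_upwards [isOpen_halfCyl.mem_nhds hp] with q hq
    simp [gradient, areaDensity_grushinMetric hq, grushinMetric_inv hq]
  have h1 : pd 1 (fun q => areaDensity (grushinMetric α) q • gradient (grushinMetric α) u 1 q) p
      = pd 1 (fun q => q.1 ^ α • pd 1 u q) p := by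
    apply pd_congr
    filter_upwards [isOpen_halfCyl.mem_nhds hp] with q hq
    have hq' : 0 < q.1 := hq
    simp only [gradient, areaDensity_grushinMetric hq, grushinMetric_inv hq, Fin.sum_univ_two]
    simp [← mul_assoc, ← Complex.ofReal_mul, ← Real.rpow_add hq']
    left; congr 1; ring
  have h0' : pd 0 (fun q => q.1 ^ (-α) • pd 0 u q) p
      = p.1 ^ (-α) • pd 0 (pd 0 u) p + (-α * p.1 ^ (-α - 1)) • pd 0 u p := by
    obtain ⟨x, y⟩ := p
    obtain ⟨y, rfl⟩ := QuotientAddGroup.mk_surjective y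
    have hd : DifferentiableAt ℝ (fun s : ℝ => pd 0 u (s, (y : AddCircle (2 * Real.pi)))) x := by
      have h2 : DifferentiableAt ℝ (lift (pd 0 u)) (x, y) :=
        (pd_mem 0 hu).1.differentiable (by simp) _
      exact h2.comp (f := fun s : ℝ => (s, y)) x (by fun_prop)
    rw [pd_zero_apply, pd_zero_apply (pd 0 u)]
    exact ((Real.hasDerivAt_rpow_const (Or.inl (ne_of_gt hx))).smul hd.hasDerivAt).deriv
  have h1' : pd 1 (fun q => q.1 ^ α • pd 1 u q) p = p.1 ^ α • pd 1 (pd 1 u) p := by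
    simp only [pd, coordShift]
    simp
  unfold laplaceBeltrami divergence
  rw [Fin.sum_univ_two, h0, h1, h0', h1', areaDensity_grushinMetric hp]
  have e1 : (p.1 ^ (-α))⁻¹ * p.1 ^ (-α) = 1 :=
    inv_mul_cancel₀ (Real.rpow_pos_of_pos hx _).ne'
  have e2 : (p.1 ^ (-α))⁻¹ * (-α * p.1 ^ (-α - 1)) = -(α / p.1) := by
    rw [Real.rpow_sub hx, Real.rpow_one, ← mul_one (-(α / p.1)), ← e1]; ring
  have e3 : (p.1 ^ (-α))⁻¹ * p.1 ^ α = p.1 ^ (2 * α) := by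
    rw [Real.rpow_neg hx.le, inv_inv, ← Real.rpow_add hx]; congr 1; ring
  rw [smul_add, smul_add, smul_smul, smul_smul, smul_smul, e1, e2, e3, one_smul, neg_smul]
  ring

theorem laplaceBeltrami_zero {α : ℝ} {u : Cyl → ℂ} {p : Cyl} (hp : p ∉ tsupport u) :
    laplaceBeltrami (grushinMetric α) u p = 0 := by
  have h0 : ∀ᶠ q in 𝓝 p, ∀ i, gradient (grushinMetric α) u i q = 0 := by
    filter_upwards [(notMem_tsupport_iff_eventuallyEq.1 hp).eventuallyEq_nhds] with q hq i
    have : ∀ j, pd j u q = 0 := fun j => by rw [pd_congr j hq]; simp [pd]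
    simp [gradient, this]
  unfold laplaceBeltrami divergence
  have h1 : ∀ i, pd i (fun q => areaDensity (grushinMetric α) q •
      gradient (grushinMetric α) u i q) p = 0 := fun i => by
    rw [pd_congr i (v := fun _ => 0) (h0.mono fun q hq => by simp [hq])]
    simp [pd]
  simp only [h1, Finset.sum_const_zero, smul_zero]

theorem curvatureExpr_eq (α c : ℝ) {u : Cyl → ℂ} (hu : u ∈ testFunctions) :
    curvatureExpr (grushinMetric α) c u = fun p =>
      (-1 : ℂ) • pd 0 (pd 0 u) p + (-p.1 ^ (2 * α)) • pd 1 (pd 1 u) p + (α / p.1) • pd 0 u p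
        + (c * (-(α * (α + 1)) / p.1 ^ 2)) • u p := by
  funext p
  by_cases hp : p ∈ halfCyl
  · rw [curvatureExpr, laplaceBeltrami_grushinMetric hu hp, gaussCurvature_grushinMetric hp,
      neg_smul, neg_smul, one_smul]
    ring
  · have hn : ∀ v ∈ testFunctions, v p = 0 := fun v hv =>
      image_eq_zero_of_notMem_tsupport fun h => hp (hv.2.2 h)
    rw [curvatureExpr, laplaceBeltrami_zero fun h => hp (hu.2.2 h), hn u hu,
      hn _ (pd_mem 0 hu), hn _ (pd_mem 0 (pd_mem 0 hu)), hn _ (pd_mem 1 (pd_mem 1 hu))]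
    simp

theorem curvatureExpr_mem (α c : ℝ) {u : Cyl → ℂ} (hu : u ∈ testFunctions) :
    curvatureExpr (grushinMetric α) c u ∈ testFunctions := by
  rw [curvatureExpr_eq α c hu]
  have hr : ∀ s : ℝ, ContDiffOn ℝ ∞ (fun x : ℝ => x ^ s) (Ioi 0) := fun s x hx =>
    (Real.contDiffAt_rpow_const_of_ne (ne_of_gt hx)).contDiffWithinAt
  refine add_mem (add_mem (add_mem (testFunctions.smul_mem _ (pd_mem 0 (pd_mem 0 hu)))
    (mul_mem (a := fun x => -x ^ (2 * α)) (hr _).neg (pd_mem 1 (pd_mem 1 hu))))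
    (mul_mem (a := fun x => α / x) ?_ (pd_mem 0 hu)))
    (mul_mem (a := fun x => c * (-(α * (α + 1)) / x ^ 2)) ?_ hu)
  · exact contDiffOn_const.div contDiffOn_id fun x hx => ne_of_gt hx
  · exact contDiffOn_const.mul (contDiffOn_const.div (contDiffOn_id.pow 2)
      fun x hx => pow_ne_zero 2 (ne_of_gt hx))

/-- The map `u ↦ -Δ_α u + c K_α u` on `C₀^∞(ℝ₊ × S¹)`. -/
def curvatureMap (α c : ℝ) : testFunctions →ₗ[ℂ] testFunctions where
  toFun u := ⟨curvatureExpr (grushinMetric α) c u, curvatureExpr_mem α c u.2⟩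
  map_add' u v := by
    apply Subtype.ext
    change curvatureExpr _ c (u.1 + v.1) = curvatureExpr _ c u.1 + curvatureExpr _ c v.1
    rw [curvatureExpr_eq α c u.2, curvatureExpr_eq α c v.2,
      curvatureExpr_eq α c (add_mem u.2 v.2), pd_add 0 u.2 v.2, pd_add 1 u.2 v.2,
      pd_add 0 (pd_mem 0 u.2) (pd_mem 0 v.2), pd_add 1 (pd_mem 1 u.2) (pd_mem 1 v.2)]
    funext p
    simp only [Pi.add_apply, smul_add]
    ring
  map_smul' z u := by
    apply Subtype.ext
    change curvatureExpr _ c (z • u.1) = z • curvatureExpr _ c u.1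
    rw [curvatureExpr_eq α c u.2, curvatureExpr_eq α c (testFunctions.smul_mem z u.2),
      pd_smul, pd_smul, pd_smul, pd_smul]
    funext p
    simp only [Pi.smul_apply, smul_add, smul_comm z]

theorem testFunctions_memLp (α : ℝ) {u : Cyl → ℂ} (hu : u ∈ testFunctions) :
    MemLp u 2 (grushinMeasure α) := by
  have hc := testFunctions_continuous hu
  have hK : IsCompact (tsupport u) := hu.2.1
  have hmeas : MeasurableSet (tsupport u) := (isClosed_tsupport u).measurableSet
  have hfin : grushinMeasure α (tsupport u) < ⊤ := by
    have hcont : ContinuousOn (fun p : Cyl => p.1 ^ (-α)) (tsupport u) := fun p hp =>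
      (continuousAt_fst.rpow_const (Or.inl (ne_of_gt (hu.2.2 hp)))).continuousWithinAt
    obtain ⟨C, hC⟩ := hK.exists_bound_of_continuousOn hcont
    rw [grushinMeasure, withDensity_apply _ hmeas]
    refine lt_of_le_of_lt (setLIntegral_mono (g := fun _ => ENNReal.ofReal C)
      measurable_const fun p hp =>
        ENNReal.ofReal_le_ofReal ((Real.le_norm_self _).trans (hC p hp))) ?_
    rw [setLIntegral_const]
    exact ENNReal.mul_lt_top ENNReal.ofReal_lt_top
      (lt_of_le_of_lt (Measure.restrict_apply_le _ _) hK.measure_lt_top)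
  obtain ⟨C, hC⟩ := hK.exists_bound_of_continuousOn hc.continuousOn
  have : IsFiniteMeasure ((grushinMeasure α).restrict (tsupport u)) :=
    ⟨by rwa [Measure.restrict_apply_univ]⟩
  have h1 : MemLp u 2 ((grushinMeasure α).restrict (tsupport u)) :=
    MemLp.of_bound hc.aestronglyMeasurable C
      ((ae_restrict_iff' hmeas).2 (Eventually.of_forall hC))
  rw [← memLp_indicator_iff_restrict hmeas] at h1
  rwa [indicator_eq_self.2 (subset_tsupport u)] at h1

/-- The inclusion `C₀^∞(ℝ₊ × S¹) → L²(ℝ₊ × S¹, x^{-α} dx dy)`. -/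
def toL2 (α : ℝ) : testFunctions →ₗ[ℂ] Lp ℂ 2 (grushinMeasure α) where
  toFun u := (testFunctions_memLp α u.2).toLp u.1
  map_add' _ _ := rfl
  map_smul' _ _ := rfl

theorem toL2_injective (α : ℝ) : Function.Injective (toL2 α) := by
  intro u v h
  have h1 : u.1 =ᵐ[grushinMeasure α] v.1 :=
    (MemLp.toLp_eq_toLp_iff (testFunctions_memLp α u.2) (testFunctions_memLp α v.2)).1 h
  have hm : Measurable fun p : Cyl => ENNReal.ofReal (p.1 ^ (-α)) := by fun_prop
  have h2 : u.1 =ᵐ[volume.restrict halfCyl] v.1 := by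
    have h3 := (ae_withDensity_iff hm).1 h1
    filter_upwards [h3, ae_restrict_mem isOpen_halfCyl.measurableSet] with p hp hpp
    exact hp (ENNReal.ofReal_pos.2 (Real.rpow_pos_of_pos hpp _)).ne'
  have h3 := Measure.eqOn_open_of_ae_eq h2 isOpen_halfCyl
    (testFunctions_continuous u.2).continuousOn (testFunctions_continuous v.2).continuousOn
  apply Subtype.ext
  funext p
  by_cases hp : p ∈ halfCyl
  · exact h3 hp
  · rw [image_eq_zero_of_notMem_tsupport fun h => hp (u.2.2.2 h),
      image_eq_zero_of_notMem_tsupport fun h => hp (v.2.2.2 h)]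

/-! ### The operator and essential self-adjointness -/

/-- The curvature Laplacian `-Δ_α + c K_α` with domain `C₀^∞(ℝ₊ × S¹)`, as an operator on
`L²(ℝ₊ × S¹, x^{-α} dx dy)`. -/
def curvatureLaplacian (α c : ℝ) :
    Lp ℂ 2 (grushinMeasure α) →ₗ.[ℂ] Lp ℂ 2 (grushinMeasure α) where
  domain := LinearMap.range (toL2 α)
  toFun := toL2 α ∘ₗ curvatureMap α c ∘ₗ
    (LinearEquiv.ofInjective (toL2 α) (toL2_injective α)).symm.toLinearMap

theorem curvatureLaplacian_apply (α c : ℝ) (u : testFunctions) :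
    curvatureLaplacian α c ⟨toL2 α u, LinearMap.mem_range_self _ u⟩ =
      toL2 α (curvatureMap α c u) := by
  exact congrArg (fun v => toL2 α (curvatureMap α c v))
    ((LinearEquiv.ofInjective (toL2 α) (toL2_injective α)).symm_apply_apply u)

/-- An operator on a Hilbert space is essentially self-adjoint if its closure is self-adjoint.
(If the operator is not closable, Mathlib's `closure` is the operator itself, which is then not
self-adjoint, because self-adjoint operators are closed.) -/
def IsEssentiallySelfAdjoint {H : Type*} [NormedAddCommGroup H] [InnerProductSpace ℂ H]
    [CompleteSpace H] (A : H →ₗ.[ℂ] H) : Prop :=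
  IsSelfAdjoint A.closure

/-- The number `α_{c,+}`. -/
def alphaPlus (c : ℝ) : ℝ :=
  ((-2 * c + 1) + 2 * √((c - 2 + √3) * (c - 2 - √3))) / (4 * c - 1)

/-- The number `α_{c,-}`. -/
def alphaMinus (c : ℝ) : ℝ :=
  ((-2 * c + 1) - 2 * √((c - 2 + √3) * (c - 2 - √3))) / (4 * c - 1)

end GrushinCylinder

end

/-! ### Hilbert space: deficiency spaces and self-adjointness of the closure -/

noncomputable section

namespace LinearPMap

variable {H : Type*} [NormedAddCommGroup H] [InnerProductSpace ℂ H]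

/-! Here K = -α(α+1)/x². The substitution u = x^{α/2} w turns the weight x^{-α} dx into dx, and the
Fourier expansion in y splits -Δ + cK into the half-line operators -w'' + (m/x² + k² x^{2α}) w, with
k ∈ ℤ and m = α²/4 + α/2 - cα(α+1). Everything depends on whether m ≥ 3/4, the limit-point threshold
for an inverse-square potential at 0; multiplied out, this is (1-4c)α² + (2-4c)α - 3 ≥ 0
(`isEssentiallySelfAdjoint_iff`).

If m ≥ 3/4, let v be orthogonal to the range of A ± i. Each Fourier coefficient of v is a weak,
hence classical, L² solution of w'' = Ww with Re W ≥ 3/(4x²), because k² x^{2α} ≥ 0 and ±i is purely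
imaginary (`weak_angularCoeff`, `exists_classical_solution`). A convexity argument for |w|²/x shows
that w = 0 (`eq_zero_of_integrable_sq`). So v = 0 by Parseval, and the deficiency criterion
`isSelfAdjoint_closure_of_deficiency` applies.

If m < 3/4, the mode k = 0 already obstructs. Both solutions of its Euler equation are
square-integrable at 0; cut off near infinity, they lie in the domain of the adjoint, and their
boundary form is minus their Wronskian, which is not 0. But a self-adjoint closure would make the
adjoint symmetric (`not_isEssentiallySelfAdjoint`). The listed ranges of α then come from the roots
of the quadratic, whose discriminant is 16(c² - 4c + 1). -/

theorem adjoint_topologicalClosure (g : Submodule ℂ (H × H)) :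
    g.topologicalClosure.adjoint = g.adjoint := by
  ext x
  simp only [Submodule.mem_adjoint_iff]
  refine ⟨fun h a b hab => h a b (g.le_topologicalClosure hab), fun h a b hab => ?_⟩
  have hc : _root_.IsClosed {p : H × H | inner ℂ p.2 x.1 - inner ℂ p.1 x.2 = 0} :=
    isClosed_eq (by fun_prop) continuous_const
  exact closure_minimal (s := (g : Set (H × H))) (fun p hp => h p.1 p.2 hp) hc hab

theorem isClosed_submodule_adjoint (g : Submodule ℂ (H × H)) :
    _root_.IsClosed (g.adjoint : Set (H × H)) := by
  have : (g.adjoint : Set (H × H)) =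
      ⋂ p ∈ (g : Set (H × H)), {x : H × H | inner ℂ p.2 x.1 - inner ℂ p.1 x.2 = 0} := by
    ext x
    simp [Submodule.mem_adjoint_iff]
  rw [this]
  exact isClosed_biInter fun p _ => isClosed_eq (by fun_prop) continuous_const

variable [CompleteSpace H] {A : H →ₗ.[ℂ] H}

/-- The basic criterion: a densely defined symmetric operator with trivial deficiency spaces is
essentially self-adjoint. -/
theorem isSelfAdjoint_closure_of_deficiency (hd : Dense (A.domain : Set H))
    (hs : A.IsFormalAdjoint A)
    (hp : ∀ v : H, (∀ x : A.domain, inner ℂ (A x + Complex.I • (x : H)) v = 0) → v = 0)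
    (hm : ∀ v : H, (∀ x : A.domain, inner ℂ (A x - Complex.I • (x : H)) v = 0) → v = 0) :
    IsSelfAdjoint A.closure := by
  have hle : A ≤ A.adjoint := hs.le_adjoint hd
  have hcl : A.IsClosable := (adjoint_isClosed hd).isClosable.leIsClosable hle
  have hd' : Dense (A.closure.domain : Set H) := hd.mono A.le_closure.1
  -- Γ is the graph of the closure. Since A and its closure have the same adjoint, what has to be
  -- shown is that the graph of the adjoint is contained in Γ.
  set Γ := A.graph.topologicalClosure with hΓ
  have hΓc : _root_.IsClosed (Γ : Set (H × H)) := A.graph.isClosed_topologicalClosure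
  have hΓA : Γ.adjoint = A.graph.adjoint := adjoint_topologicalClosure _
  have hsub : Γ ≤ A.graph.adjoint := by
    refine A.graph.topologicalClosure_minimal ?_ (isClosed_submodule_adjoint _)
    rw [← adjoint_graph_eq_graph_adjoint hd]
    exact le_graph_of_le hle
  rw [isSelfAdjoint_def]
  apply eq_of_eq_graph
  rw [adjoint_graph_eq_graph_adjoint hd', ← hcl.graph_closure_eq_closure_graph, ← hΓ, hΓA]
  refine le_antisymm ?_ hsub
  -- M is "closure of A, plus i" on the graph. Symmetry makes ⟨Ax, x⟩ real, so the cross term in ‖Ax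
  -- + ix‖² vanishes; hence M is bounded below and has closed range, and `hp` makes the range dense.
  let M : Γ →L[ℂ] H := (ContinuousLinearMap.snd ℂ H H +
    Complex.I • ContinuousLinearMap.fst ℂ H H).comp Γ.subtypeL
  have hM : ∀ p : Γ, M p = p.1.2 + Complex.I • p.1.1 := fun p => rfl
  have hnorm : ∀ p : Γ, ‖M p‖ ^ 2 = ‖p.1.2‖ ^ 2 + ‖p.1.1‖ ^ 2 := by
    intro p
    have h1 := hsub p.2
    rw [← hΓA, Submodule.mem_adjoint_iff] at h1
    have h2 := sub_eq_zero.1 (h1 p.1.1 p.1.2 p.2)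
    have h3 : (inner ℂ p.1.2 p.1.1).im = 0 := by
      rw [← Complex.conj_eq_iff_im, inner_conj_symm, h2]
    have h4 : RCLike.re (inner ℂ p.1.2 (Complex.I • p.1.1)) = 0 := by
      rw [inner_smul_right]
      simp [h3]
    rw [hM, norm_add_sq (𝕜 := ℂ), h4, norm_smul]
    simp
  have : CompleteSpace Γ := hΓc.completeSpace_coe
  have hanti : AntilipschitzWith 1 M := by
    refine M.antilipschitz_of_bound fun p => ?_
    rw [NNReal.coe_one, one_mul]
    have h := hnorm p
    change ‖p.1‖ ≤ _
    refine max_le ?_ ?_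
    · exact abs_le_of_sq_le_sq' (by nlinarith [sq_nonneg ‖p.1.2‖]) (norm_nonneg _) |>.2
    · exact abs_le_of_sq_le_sq' (by nlinarith [sq_nonneg ‖p.1.1‖]) (norm_nonneg _) |>.2
  have hclosed : _root_.IsClosed (LinearMap.range M.toLinearMap : Set H) := by
    rw [LinearMap.coe_range]
    exact hanti.isClosed_range M.uniformContinuous
  have hrange : LinearMap.range M.toLinearMap = ⊤ := by
    have : CompleteSpace (LinearMap.range M.toLinearMap) := hclosed.completeSpace_coe
    rw [← Submodule.orthogonal_eq_bot_iff, Submodule.eq_bot_iff]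
    intro v hv
    rw [Submodule.mem_orthogonal] at hv
    refine hp v fun x => ?_
    exact hv _ ⟨⟨((x : H), A x), A.graph.le_topologicalClosure (A.mem_graph x)⟩, rfl⟩
  rintro ⟨v, z⟩ hvz
  -- Surjectivity of M gives p ∈ Γ with the same image as (v, z). The difference lies in the kernel
  -- of A* + i, the orthogonal complement of the range of A - i, which is trivial by `hm`.
  obtain ⟨p, hpe⟩ : z + Complex.I • v ∈ LinearMap.range M.toLinearMap := hrange ▸ Submodule.mem_top
  have hpe' : p.1.2 + Complex.I • p.1.1 = z + Complex.I • v := hpe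
  have hdiff : ((v, z) - p.1 : H × H) ∈ A.graph.adjoint := sub_mem hvz (hsub p.2)
  have hz : z - p.1.2 = -(Complex.I • (v - p.1.1)) := by
    rw [smul_sub, neg_sub, sub_eq_sub_iff_add_eq_add, add_comm (Complex.I • p.1.1), hpe']
  have hv : v - p.1.1 = 0 := by
    refine hm _ fun x => ?_
    rw [Submodule.mem_adjoint_iff] at hdiff
    have h := hdiff _ _ (A.mem_graph x)
    simp only [Prod.fst_sub, Prod.snd_sub] at h
    rw [hz, inner_neg_right, inner_smul_right] at h
    rw [inner_sub_left, inner_smul_left, ← h]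
    simp
  have hz0 : z - p.1.2 = 0 := by rw [hz, hv]; simp
  have : (v, z) = p.1 := Prod.ext (sub_eq_zero.1 hv) (sub_eq_zero.1 hz0)
  rw [this]
  exact p.2

/-- If the closure is self-adjoint, the adjoint is symmetric. -/
theorem inner_eq_of_isSelfAdjoint_closure (h : IsSelfAdjoint A.closure) {u u' v v' : H}
    (hu : ∀ x : A.domain, inner ℂ (A x) u = inner ℂ (x : H) u')
    (hv : ∀ x : A.domain, inner ℂ (A x) v = inner ℂ (x : H) v') :
    inner ℂ u' v = inner ℂ u v' := by
  have hd' := h.dense_domain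
  have hcl : A.IsClosable := isClosable_iff_exists_closed_extension.2
    ⟨A.closure, h.isClosed, A.le_closure⟩
  -- The adjoint of A is the adjoint of its closure, hence the closure itself. Both given pairs
  -- therefore lie in the graph of a self-adjoint operator.
  have hg : A.graph.adjoint = A.closure.graph := by
    rw [← adjoint_topologicalClosure, hcl.graph_closure_eq_closure_graph,
      ← adjoint_graph_eq_graph_adjoint hd', isSelfAdjoint_def.1 h]
  have mem : ∀ {w w' : H}, (∀ x : A.domain, inner ℂ (A x) w = inner ℂ (x : H) w') →
      (w, w') ∈ A.closure.graph := by
    intro w w' hw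
    rw [← hg, Submodule.mem_adjoint_iff]
    intro a b hab
    obtain ⟨x, rfl, rfl⟩ := A.mem_graph_iff.1 hab
    exact sub_eq_zero.2 (hw x)
  have h1 := mem hu
  have h2 := mem hv
  have h3 : A.closure.graph = A.closure.graph.adjoint := by
    rw [← adjoint_graph_eq_graph_adjoint hd', isSelfAdjoint_def.1 h]
  rw [h3, Submodule.mem_adjoint_iff] at h2
  exact sub_eq_zero.1 (h2 _ _ h1)

end LinearPMap

end

/-! ### The half-line: weak solutions and the inverse-square bound -/

noncomputable section

namespace HalfLine

/-- The real test functions on `(0, ∞)`. -/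
structure IsTest (g : ℝ → ℝ) : Prop where
  contDiff : ContDiff ℝ ∞ g
  hasCompactSupport : HasCompactSupport g
  tsupport_subset : tsupport g ⊆ Ioi 0

/-- The point 1 is adjoined to K because it is the base point of the primitives used below. -/
theorem exists_Icc_of_isCompact {K : Set ℝ} (hK : IsCompact K) (hp : K ⊆ Ioi 0) :
    ∃ a b, 0 < a ∧ a < 1 ∧ 1 < b ∧ K ⊆ Ioo a b := by
  have hc : IsCompact (insert 1 K) := hK.insert 1
  have hn : (insert 1 K).Nonempty := ⟨1, mem_insert _ _⟩
  have h1 := hc.sInf_mem hn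
  have hpos : 0 < sInf (insert 1 K) := by
    rcases h1 with h | h
    · rw [h]; exact one_pos
    · exact hp h
  have hl : ∀ x ∈ insert 1 K, sInf (insert 1 K) ≤ x := fun x hx => csInf_le hc.bddBelow hx
  have hu : ∀ x ∈ insert 1 K, x ≤ sSup (insert 1 K) := fun x hx => le_csSup hc.bddAbove hx
  refine ⟨sInf (insert 1 K) / 2, sSup (insert 1 K) + 1, by linarith, ?_, ?_, fun x hx => ⟨?_, ?_⟩⟩
  · linarith [hl 1 (mem_insert _ _)]
  · linarith [hu 1 (mem_insert _ _)]
  · linarith [hl x (mem_insert_of_mem _ hx)]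
  · linarith [hu x (mem_insert_of_mem _ hx)]

theorem IsTest.exists_Icc {g : ℝ → ℝ} (hg : IsTest g) :
    ∃ a b, 0 < a ∧ a < 1 ∧ 1 < b ∧ ∀ x, x ∉ Ioo a b → g x = 0 := by
  obtain ⟨a, b, h0, h1, h2, h⟩ := exists_Icc_of_isCompact hg.hasCompactSupport hg.tsupport_subset
  exact ⟨a, b, h0, h1, h2, fun x hx => image_eq_zero_of_notMem_tsupport fun hn => hx (h hn)⟩

theorem IsTest.deriv {g : ℝ → ℝ} (hg : IsTest g) : IsTest (deriv g) :=
  ⟨(contDiff_infty_iff_deriv.1 hg.contDiff).2, hg.hasCompactSupport.deriv,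
    (tsupport_deriv_subset).trans hg.tsupport_subset⟩

theorem IsTest.differentiable {g : ℝ → ℝ} (hg : IsTest g) : Differentiable ℝ g :=
  (contDiff_infty_iff_deriv.1 hg.contDiff).1

theorem IsTest.continuous {g : ℝ → ℝ} (hg : IsTest g) : Continuous g :=
  hg.contDiff.continuous

theorem IsTest.add_const_mul {g h : ℝ → ℝ} (hg : IsTest g) (hh : IsTest h) (c : ℝ) :
    IsTest (fun x => g x + c * h x) := by
  have hs : HasCompactSupport (fun x => c * h x) := hh.hasCompactSupport.mul_left
  have ht : tsupport (fun x => c * h x) ⊆ Ioi 0 :=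
    (tsupport_mul_subset_right (f := fun _ => c) (g := h)).trans hh.tsupport_subset
  exact ⟨hg.contDiff.add (contDiff_const.mul hh.contDiff), hg.hasCompactSupport.add hs,
    (tsupport_add g _).trans (union_subset hg.tsupport_subset ht)⟩

theorem isTest_of_forall {g : ℝ → ℝ} (hg : ContDiff ℝ ∞ g) {a b : ℝ} (ha : 0 < a)
    (h : ∀ x, x ∉ Icc a b → g x = 0) : IsTest g := by
  have hs : Function.support g ⊆ Icc a b := fun x hx => by_contra fun hn => hx (h x hn)
  exact ⟨hg, HasCompactSupport.of_support_subset_isCompact isCompact_Icc hs,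
    (closure_minimal hs isClosed_Icc).trans fun x hx => ha.trans_le hx.1⟩

theorem exists_isTest_integral_eq_one : ∃ η : ℝ → ℝ, IsTest η ∧ ∫ x, η x = 1 := by
  let f : ContDiffBump (2 : ℝ) := ⟨1 / 2, 1, by norm_num, by norm_num⟩
  refine ⟨f.normed volume, ⟨f.contDiff_normed, f.hasCompactSupport_normed, ?_⟩, f.integral_normed⟩
  rw [f.tsupport_normed_eq, Real.closedBall_eq_Icc]
  intro x hx
  have : (2 : ℝ) - 1 ≤ x := hx.1
  exact lt_of_lt_of_le (by norm_num : (0 : ℝ) < 2 - 1) this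

/-- The primitive starting to the left of the support vanishes again to its right exactly because
the mean is zero. -/
theorem IsTest.exists_primitive {θ : ℝ → ℝ} (hθ : IsTest θ) (h0 : ∫ x, θ x = 0) :
    ∃ g, IsTest g ∧ _root_.deriv g = θ := by
  obtain ⟨a, b, ha, -, -, hab⟩ := hθ.exists_Icc
  have hd : ∀ x, HasDerivAt (fun x => ∫ t in a..x, θ t) (θ x) x := fun x =>
    intervalIntegral.integral_hasDerivAt_right (hθ.continuous.intervalIntegrable _ _)
      hθ.continuous.aestronglyMeasurable.stronglyMeasurableAtFilter hθ.continuous.continuousAt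
  have hde : _root_.deriv (fun x => ∫ t in a..x, θ t) = θ := funext fun x => (hd x).deriv
  refine ⟨fun x => ∫ t in a..x, θ t, isTest_of_forall (a := a) (b := b) ?_ ha ?_, hde⟩
  · rw [contDiff_infty_iff_deriv, hde]
    exact ⟨fun x => (hd x).differentiableAt, hθ.contDiff⟩
  · intro x hx
    by_cases hxa : x < a
    · apply intervalIntegral.integral_zero_ae
      refine Eventually.of_forall fun t ht => hab t fun h => ?_
      rw [uIoc_of_ge hxa.le] at ht
      exact absurd h.1 (not_lt.2 ht.2)
    · have hxb : b < x := by
        by_contra hb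
        exact hx ⟨not_lt.1 hxa, not_lt.1 hb⟩
      rw [← h0, intervalIntegral.integral_of_le (not_lt.1 hxa)]
      apply setIntegral_eq_integral_of_forall_compl_eq_zero
      intro t ht
      apply hab
      intro h
      exact ht ⟨h.1, (h.2.trans hxb).le⟩

theorem IsTest.integrable_smul {E : Type*} [NormedAddCommGroup E] [NormedSpace ℝ E]
    {g : ℝ → ℝ} (hg : IsTest g) {H : ℝ → E} (hH : LocallyIntegrableOn H (Ioi 0)) :
    IntegrableOn (fun x => g x • H x) (Ioi 0) := by
  obtain ⟨a, b, ha, -, -, hab⟩ := hg.exists_Icc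
  have h1 : IntegrableOn H (Icc a b) :=
    hH.integrableOn_compact_subset (fun x hx => ha.trans_le hx.1) isCompact_Icc
  have h2 : IntegrableOn (fun x => g x • H x) (Icc a b) :=
    h1.continuousOn_smul hg.continuous.continuousOn isCompact_Icc
  refine IntegrableOn.of_forall_sdiff_eq_zero h2 measurableSet_Ioi ?_
  intro x hx
  rw [hab x fun h => hx.2 ⟨h.1.le, h.2.le⟩, zero_smul]

/-- The lemma of du Bois-Reymond on the half-line. -/
theorem ae_eq_const_of_integral_deriv {H : ℝ → ℂ} (hH : LocallyIntegrableOn H (Ioi 0))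
    (h : ∀ g, IsTest g → ∫ x in Ioi 0, deriv g x • H x = 0) :
    ∃ c, ∀ᵐ x, x ∈ Ioi (0 : ℝ) → H x = c := by
  obtain ⟨η, hη, hη1⟩ := exists_isTest_integral_eq_one
  set c := ∫ x in Ioi 0, η x • H x with hc
  have hloc : LocallyIntegrableOn (fun x => H x - c) (Ioi 0) :=
    hH.sub (continuousOn_const.locallyIntegrableOn measurableSet_Ioi)
  refine ⟨c, ?_⟩
  have := isOpen_Ioi.ae_eq_zero_of_integral_contDiff_smul_eq_zero (μ := volume) hloc ?_
  · filter_upwards [this] with x hx hx0 using sub_eq_zero.1 (hx hx0)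
  intro θ h1 h2 h3
  have hθ : IsTest θ := ⟨h1, h2, h3⟩
  have hint : ∀ {g : ℝ → ℝ}, IsTest g → Integrable g := fun hg =>
    hg.continuous.integrable_of_hasCompactSupport hg.hasCompactSupport
  -- Subtracting (∫ θ) η makes the mean zero, so the result is the derivative of a test function.
  obtain ⟨g, hg, hgd⟩ := (hθ.add_const_mul hη (-∫ x, θ x)).exists_primitive (by
    rw [integral_add (hint hθ) ((hint hη).const_mul _), integral_const_mul, hη1]
    ring)
  have h4 := h g hg
  rw [hgd] at h4
  have h5 : ∀ x, (θ x + -(∫ x, θ x) * η x) • H x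
      = θ x • H x - (∫ x, θ x) • (η x • H x) := fun x => by
    rw [add_smul, neg_mul, neg_smul, mul_smul, sub_eq_add_neg]
  simp only [h5] at h4
  rw [integral_sub (hθ.integrable_smul hH) ((hη.integrable_smul hH).fun_smul _), integral_smul,
    ← hc] at h4
  have hset : ∀ {E : Type} [NormedAddCommGroup E] [NormedSpace ℝ E] (f : ℝ → E),
      (∀ x, θ x = 0 → f x = 0) → ∫ x in Ioi 0, f x = ∫ x, f x := by
    intro E _ _ f hf
    refine setIntegral_eq_integral_of_forall_compl_eq_zero fun x hx => hf x ?_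
    exact image_eq_zero_of_notMem_tsupport fun hn => hx (h3 hn)
  rw [← hset _ fun x hx => by rw [hx, zero_smul]]
  simp only [smul_sub]
  rw [integral_sub (hθ.integrable_smul hH)
    ((hint hθ).smul_const c).integrableOn, integral_smul_const, hset _ fun x hx => hx]
  exact h4

theorem hasDerivAt_primitive {f : ℝ → ℂ} (hf : ContinuousOn f (Ioi 0)) {x : ℝ} (hx : 0 < x) :
    HasDerivAt (fun x => ∫ t in (1 : ℝ)..x, f t) (f x) x := by
  refine intervalIntegral.integral_hasDerivAt_right ?_ ?_ (hf.continuousAt (Ioi_mem_nhds hx))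
  · refine (hf.mono ?_).intervalIntegrable
    intro t ht
    exact (lt_min one_pos hx).trans_le ht.1
  · exact hf.stronglyMeasurableAtFilter isOpen_Ioi x hx

theorem intervalIntegrable_of_locallyIntegrableOn {E : Type*} [NormedAddCommGroup E] {F : ℝ → E}
    (hF : LocallyIntegrableOn F (Ioi 0)) {a b : ℝ} (ha : 0 < a) (hb : 0 < b) :
    IntervalIntegrable F volume a b :=
  (hF.integrableOn_compact_subset (fun _ ht => (lt_min ha hb).trans_le ht.1)
    isCompact_uIcc).intervalIntegrable

theorem continuousOn_primitive {F : ℝ → ℂ} (hF : LocallyIntegrableOn F (Ioi 0)) :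
    ContinuousOn (fun x => ∫ t in (1 : ℝ)..x, F t) (Ioi 0) := by
  intro x hx
  have hx0 : (0 : ℝ) < x := hx
  have hm : 0 < min 1 x / 2 := half_pos (lt_min one_pos hx0)
  have h := intervalIntegral.continuousOn_primitive_interval'
    (intervalIntegrable_of_locallyIntegrableOn hF hm (show 0 < x + 2 by linarith))
    (a := 1) ?_
  · refine (h.continuousAt ?_).continuousWithinAt
    rw [uIcc_of_le (by linarith [min_le_right 1 x])]
    exact Icc_mem_nhds (by linarith [min_le_right 1 x]) (by linarith)
  · rw [uIcc_of_le (by linarith [min_le_right 1 x])]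
    exact ⟨by linarith [min_le_left 1 x], by linarith⟩

/-- Integration by parts for absolutely continuous functions: the primitive of F has derivative F
almost everywhere, and g kills the boundary terms. -/
theorem integral_deriv_mul_primitive_real {F : ℝ → ℝ} (hF : LocallyIntegrableOn F (Ioi 0))
    {g : ℝ → ℝ} (hg : IsTest g) :
    ∫ x in Ioi 0, deriv g x * (∫ t in (1 : ℝ)..x, F t) = -∫ x in Ioi 0, g x * F x := by
  obtain ⟨a, b, ha, ha1, hb1, hab⟩ := hg.exists_Icc
  have hdz : ∀ x, x ∉ Icc a b → deriv g x = 0 := by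
    intro x hx
    have : g =ᶠ[𝓝 x] fun _ => 0 := by
      filter_upwards [isClosed_Icc.isOpen_compl.mem_nhds hx] with y hy
      exact hab y fun h => hy ⟨h.1.le, h.2.le⟩
    rw [this.deriv_eq, deriv_const]
  have hsub : Icc a b ⊆ Ioi 0 := fun x hx => ha.trans_le hx.1
  have hle : a ≤ b := (ha1.trans hb1).le
  have hred : ∀ f : ℝ → ℝ, (∀ x, x ∉ Icc a b → f x = 0) →
      ∫ x in Ioi 0, f x = ∫ x in a..b, f x := by
    intro f hf
    rw [intervalIntegral.integral_of_le hle, ← integral_Icc_eq_integral_Ioc]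
    exact setIntegral_eq_of_subset_of_forall_sdiff_eq_zero measurableSet_Ioi hsub
      fun x hx => hf x hx.2
  rw [hred _ fun x hx => by rw [hdz x hx, zero_mul],
    hred _ fun x hx => by rw [hab x fun h => hx ⟨h.1.le, h.2.le⟩, zero_mul]]
  have hFi : IntervalIntegrable F volume a b :=
    intervalIntegrable_of_locallyIntegrableOn hF ha (one_pos.trans hb1)
  have h1 : (1 : ℝ) ∈ uIcc a b := by rw [uIcc_of_le hle]; exact ⟨ha1.le, hb1.le⟩
  have hGac := hFi.absolutelyContinuousOnInterval_intervalIntegral h1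
  have hgac : AbsolutelyContinuousOnInterval g a b :=
    (hg.contDiff.of_le (by simp)).contDiffOn.absolutelyContinuousOnInterval
  have h2 := hGac.integral_mul_deriv_eq_deriv_mul hgac
  rw [hab a fun h => lt_irrefl _ h.1, hab b fun h => lt_irrefl _ h.2] at h2
  have h3 : ∫ x in a..b, deriv (fun x => ∫ v in (1 : ℝ)..x, F v) x * g x
      = ∫ x in a..b, g x * F x := by
    apply intervalIntegral.integral_congr_ae
    filter_upwards [hFi.ae_hasDerivAt_integral] with x hx hxI
    rw [(hx (uIoc_subset_uIcc hxI) 1 h1).deriv, mul_comm]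
  rw [h3] at h2
  rw [intervalIntegral.integral_congr fun x _ => mul_comm (deriv g x) _, h2]
  simp

/-- Real and imaginary parts commute with all the integrals, so the real case suffices. -/
theorem integral_deriv_smul_primitive {F : ℝ → ℂ} (hF : LocallyIntegrableOn F (Ioi 0))
    {g : ℝ → ℝ} (hg : IsTest g) :
    ∫ x in Ioi 0, deriv g x • (∫ t in (1 : ℝ)..x, F t) = -∫ x in Ioi 0, g x • F x := by
  have hG : LocallyIntegrableOn (fun x => ∫ t in (1 : ℝ)..x, F t) (Ioi 0) :=
    (continuousOn_primitive hF).locallyIntegrableOn measurableSet_Ioi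
  have key : ∀ L : ℂ →L[ℝ] ℝ,
      L (∫ x in Ioi 0, deriv g x • (∫ t in (1 : ℝ)..x, F t)) = L (-∫ x in Ioi 0, g x • F x) := by
    intro L
    have hLF : LocallyIntegrableOn (fun x => L (F x)) (Ioi 0) := by
      intro x hx
      obtain ⟨s, hs, hsi⟩ := hF x hx
      exact ⟨s, hs, L.integrable_comp hsi⟩
    rw [map_neg, ← L.integral_comp_comm (hg.deriv.integrable_smul hG),
      ← L.integral_comp_comm (hg.integrable_smul hF)]
    simp only [map_smul, smul_eq_mul]
    rw [← integral_deriv_mul_primitive_real hLF hg]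
    refine setIntegral_congr_fun measurableSet_Ioi fun x hx => ?_
    rw [L.intervalIntegral_comp_comm
      (intervalIntegrable_of_locallyIntegrableOn hF one_pos hx)]
  exact Complex.ext (key Complex.reCLM) (key Complex.imCLM)

/-- A weak solution of `w'' = W w` on the half-line has a `C²` representative. -/
theorem exists_classical_solution {W w : ℝ → ℂ} (hW : ContinuousOn W (Ioi 0))
    (hw : LocallyIntegrableOn w (Ioi 0))
    (h : ∀ g, IsTest g → ∫ x in Ioi 0, (deriv (deriv g) x • w x - g x • (W x * w x)) = 0) :
    ∃ v v' : ℝ → ℂ, (∀ x, 0 < x → HasDerivAt v (v' x) x) ∧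
      (∀ x, 0 < x → HasDerivAt v' (W x * v x) x) ∧ ∀ᵐ x, x ∈ Ioi (0 : ℝ) → w x = v x := by
  have hF : LocallyIntegrableOn (fun x => W x * w x) (Ioi 0) :=
    hw.continuousOn_mul hW isOpen_Ioi.isLocallyClosed
  set G : ℝ → ℂ := fun x => ∫ t in (1 : ℝ)..x, W t * w t with hGdef
  have hGc : ContinuousOn G (Ioi 0) := continuousOn_primitive hF
  have hG : LocallyIntegrableOn G (Ioi 0) := hGc.locallyIntegrableOn measurableSet_Ioi
  -- One derivative is moved off Ww, whose primitive is G: distributionally, (w' - G)' = 0.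
  have h1 : ∀ g, IsTest g →
      ∫ x in Ioi 0, (deriv (deriv g) x • w x + deriv g x • G x) = 0 := by
    intro g hg
    have h2 := h g hg
    rw [integral_sub (hg.deriv.deriv.integrable_smul hw) (hg.integrable_smul hF),
      sub_eq_add_neg, ← integral_deriv_smul_primitive hF hg] at h2
    rw [integral_add (hg.deriv.deriv.integrable_smul hw) (hg.deriv.integrable_smul hG)]
    exact h2
  obtain ⟨η, hη, hη1⟩ := exists_isTest_integral_eq_one
  set c := ∫ x in Ioi 0, (deriv η x • w x + η x • G x) with hc
  have hint : ∀ {g : ℝ → ℝ}, IsTest g → Integrable g := fun hg =>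
    hg.continuous.integrable_of_hasCompactSupport hg.hasCompactSupport
  have hi : ∀ {g : ℝ → ℝ}, IsTest g →
      IntegrableOn (fun x => deriv g x • w x + g x • G x) (Ioi 0) := fun hg =>
    (hg.deriv.integrable_smul hw).add (hg.integrable_smul hG)
  -- This says w' = G - c in the sense of distributions.
  have h3 : ∀ θ, IsTest θ →
      ∫ x in Ioi 0, (deriv θ x • w x + θ x • G x) = (∫ x, θ x) • c := by
    intro θ hθ
    obtain ⟨g, hg, hgd⟩ := (hθ.add_const_mul hη (-∫ x, θ x)).exists_primitive (by
      rw [integral_add (hint hθ) ((hint hη).const_mul _), integral_const_mul, hη1]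
      ring)
    have h4 := h1 g hg
    have h5 : ∀ x, deriv (deriv g) x • w x + deriv g x • G x
        = (deriv θ x • w x + θ x • G x) - (∫ x, θ x) • (deriv η x • w x + η x • G x) := by
      intro x
      rw [hgd]
      have : deriv (fun x => θ x + -(∫ x, θ x) * η x) x
          = deriv θ x + -(∫ x, θ x) * deriv η x :=
        ((hθ.differentiable x).hasDerivAt.add
          ((hη.differentiable x).hasDerivAt.const_mul _)).deriv
      rw [this]
      module
    simp only [h5] at h4
    rw [integral_sub (hi hθ) ((hi hη).fun_smul _), integral_smul, ← hc] at h4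
    exact sub_eq_zero.1 h4
  have hGcc : ContinuousOn (fun x => G x - c) (Ioi 0) := hGc.sub continuousOn_const
  have hGcl := hGcc.locallyIntegrableOn measurableSet_Ioi (μ := volume)
  set G2 : ℝ → ℂ := fun x => ∫ t in (1 : ℝ)..x, (G t - c) with hG2
  have hd2 : ∀ x, 0 < x → HasDerivAt G2 (G x - c) x := fun x hx => hasDerivAt_primitive hGcc hx
  have hG2c : ContinuousOn G2 (Ioi 0) := fun x hx => (hd2 x hx).continuousAt.continuousWithinAt
  have hG2l := hG2c.locallyIntegrableOn measurableSet_Ioi (μ := volume)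
  -- Since `G2` is a primitive of G - c, the difference w - `G2` has zero weak derivative.
  obtain ⟨d, hd⟩ := ae_eq_const_of_integral_deriv (hw.sub hG2l) (by
    intro θ hθ
    have h6 := h3 θ hθ
    have h7 := integral_deriv_smul_primitive hGcl hθ
    simp only [Pi.sub_apply, smul_sub]
    rw [integral_sub (hθ.deriv.integrable_smul hw) (hθ.deriv.integrable_smul hG2l), h7,
      sub_neg_eq_add]
    simp only [smul_sub]
    have hset : ∫ x in Ioi 0, θ x = ∫ x, θ x :=
      setIntegral_eq_integral_of_forall_compl_eq_zero fun x hx =>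
        image_eq_zero_of_notMem_tsupport fun hn => hx (hθ.tsupport_subset hn)
    rw [integral_sub (hθ.integrable_smul hG) ((hint hθ).smul_const c).integrableOn,
      integral_smul_const, hset, ← add_sub_assoc,
      ← integral_add (hθ.deriv.integrable_smul hw) (hθ.integrable_smul hG), h6, sub_self])
  have hwv : ∀ᵐ x, x ∈ Ioi (0 : ℝ) → w x = G2 x + d := by
    filter_upwards [hd] with x hx hx0
    rw [← hx hx0]
    simp
  refine ⟨fun x => G2 x + d, fun x => G x - c, fun x hx => (hd2 x hx).add_const d,
    fun x hx => ?_, hwv⟩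
  have hWv : ContinuousOn (fun x => W x * (G2 x + d)) (Ioi 0) :=
    hW.mul (hG2c.add continuousOn_const)
  -- Replacing w by its continuous representative does not change G but makes its integrand
  -- continuous, so G is differentiable everywhere.
  have h8 := (hasDerivAt_primitive hWv hx).sub_const c
  refine h8.congr_of_eventuallyEq ?_
  filter_upwards [Ioi_mem_nhds hx] with y hy
  simp only [hGdef]
  congr 1
  apply intervalIntegral.integral_congr_ae
  filter_upwards [hwv] with t ht htI
  rw [ht ((lt_min one_pos hy).trans htI.1)]

/-- If `Re W ≥ 3 / (4 x²)`, then `v'' = W v` has no nonzero square-integrable solution. -/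
theorem eq_zero_of_integrable_sq {W v v' : ℝ → ℂ} (hv : ∀ x, 0 < x → HasDerivAt v (v' x) x)
    (hv' : ∀ x, 0 < x → HasDerivAt v' (W x * v x) x)
    (hW : ∀ x, 0 < x → 3 / (4 * x ^ 2) ≤ (W x).re)
    (hi : IntegrableOn (fun x => ‖v x‖ ^ 2) (Ioi 0)) {x₀ : ℝ} (hx₀ : 0 < x₀) : v x₀ = 0 := by
  set f : ℝ → ℝ := fun x => ‖v x‖ ^ 2 with hf
  set p : ℝ → ℝ := fun x => inner ℝ (v x) (v' x) with hp
  have hf' : ∀ x, 0 < x → HasDerivAt f (2 * p x) x := fun x hx => (hv x hx).norm_sq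
  have hp' : ∀ x, 0 < x → HasDerivAt p ((W x).re * f x + ‖v' x‖ ^ 2) x := by
    intro x hx
    have h := (hv x hx).inner ℝ (hv' x hx)
    refine h.congr_deriv ?_
    rw [real_inner_self_eq_norm_sq, hf]
    simp only [Complex.inner, Complex.sq_norm, Complex.normSq_apply, Complex.mul_re,
      Complex.mul_im, Complex.conj_re, Complex.conj_im]
    ring
  -- With f = |v|² and f' = 2p, this is h = x³ (f/x)'. The plan is to show that h is monotone and
  -- nonnegative, hence that f/x is nondecreasing.
  set h : ℝ → ℝ := fun x => x ^ 2 * (2 * p x) - x * f x with hh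
  set h' : ℝ → ℝ := fun x => 2 * x * p x + 2 * x ^ 2 * ‖v' x‖ ^ 2
    + (2 * x ^ 2 * (W x).re - 1) * f x with hh'
  have hder : ∀ x, 0 < x → HasDerivAt h (h' x) x := by
    intro x hx
    have := (((hasDerivAt_id x).pow 2).mul ((hp' x hx).const_mul 2)).sub
      ((hasDerivAt_id x).mul (hf' x hx))
    refine this.congr_deriv ?_
    simp [hh']
    ring
  -- The bound on Re W gives 2x² Re W - 1 ≥ 1/2, so h' ≥ 2|x v' + v/2|². This is where the constant
  -- 3/4 enters.
  have hnn : ∀ x, 0 < x → 0 ≤ h' x := by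
    intro x hx
    have h1 : 0 ≤ ‖(x : ℝ) • v' x + (1 / 2 : ℝ) • v x‖ ^ 2 := sq_nonneg _
    rw [norm_add_sq_real, norm_smul, norm_smul, inner_smul_left, inner_smul_right,
      real_inner_comm] at h1
    simp only [mul_pow, Real.norm_eq_abs, sq_abs] at h1
    have h2 := hW x hx
    rw [div_le_iff₀ (by positivity)] at h2
    have h3 : 0 ≤ f x := sq_nonneg _
    have h4 : (1 / 2) * f x ≤ (2 * x ^ 2 * (W x).re - 1) * f x :=
      mul_le_mul_of_nonneg_right (by linarith) h3
    simp only [hh', hp]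
    simp only [hf] at h4 ⊢
    simp only [conj_trivial] at h1
    nlinarith
  have hcont : ∀ {u u' : ℝ → ℝ}, (∀ x, 0 < x → HasDerivAt u (u' x) x) →
      ContinuousOn u (Ioi 0) := fun hu x hx => (hu x hx).continuousAt.continuousWithinAt
  have hmono : MonotoneOn h (Ioi 0) := by
    refine monotoneOn_of_hasDerivWithinAt_nonneg (convex_Ioi 0) (hcont hder) (f' := h') ?_ ?_
    · intro x hx
      rw [interior_Ioi] at hx
      exact (hder x hx).hasDerivWithinAt
    · intro x hx
      rw [interior_Ioi] at hx
      exact hnn x hx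
  have hq : ∀ x, 0 < x → HasDerivAt (fun x => f x / x) (h x / x ^ 3) x := by
    intro x hx
    have := (hf' x hx).div (hasDerivAt_id x) hx.ne'
    refine this.congr_deriv ?_
    simp only [hh, id]
    field_simp
  -- If h(x₁) < 0, then by monotonicity (f/x)' ≤ h(x₁)/x³ on (0, x₁). Integration gives f/x ≥ κ/x² -
  -- κ/x₁², so f ≥ 3κ/(4x) for x ≤ x₁/2, which is not integrable at 0.
  have hnonneg : ∀ x, 0 < x → 0 ≤ h x := by
    intro x₁ hx₁
    by_contra hneg
    rw [not_le] at hneg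
    set κ := -h x₁ / 2 with hκ
    have hκ0 : 0 < κ := by linarith
    have hqd : ∀ x, 0 < x →
        HasDerivAt (fun x => f x / x - κ * (x ^ 2)⁻¹) (h x / x ^ 3 + 2 * κ / x ^ 3) x := by
      intro x hx
      have := (hq x hx).sub (((hasDerivAt_pow 2 x).inv (by positivity)).const_mul κ)
      refine this.congr_deriv ?_
      push_cast
      field_simp
      ring
    have hanti : AntitoneOn (fun x => f x / x - κ * (x ^ 2)⁻¹) (Ioc 0 x₁) := by
      refine antitoneOn_of_hasDerivWithinAt_nonpos (convex_Ioc 0 x₁)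
        ((hcont hqd).mono fun x hx => hx.1) (f' := fun x => h x / x ^ 3 + 2 * κ / x ^ 3) ?_ ?_
      · intro x hx
        exact (hqd x (interior_subset hx).1).hasDerivWithinAt
      · intro x hx
        have hx' := interior_subset hx
        have := hmono hx'.1 hx₁ hx'.2
        rw [← add_div]
        exact div_nonpos_of_nonpos_of_nonneg (by linarith) (pow_nonneg hx'.1.le 3)
    have hlow : ∀ x ∈ Ioc 0 (x₁ / 2), (3 * κ / 4) * x⁻¹ ≤ f x := by
      intro x hx
      have hx0 : 0 < x := hx.1
      have h5 := hanti ⟨hx0, by linarith [hx.2]⟩ (right_mem_Ioc.2 hx₁) (by linarith [hx.2])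
      simp only at h5
      have h6 : 0 ≤ f x₁ / x₁ := div_nonneg (sq_nonneg _) hx₁.le
      have h7 : κ * (x₁ ^ 2)⁻¹ ≤ κ * (x ^ 2)⁻¹ / 4 := by
        rw [mul_div_assoc]
        refine mul_le_mul_of_nonneg_left ?_ hκ0.le
        rw [inv_eq_one_div, inv_eq_one_div, div_div]
        apply one_div_le_one_div_of_le (by positivity)
        nlinarith [hx.2]
      have h8 : 3 * κ / 4 * (x ^ 2)⁻¹ ≤ f x / x := by linarith
      rw [le_div_iff₀ hx0] at h8
      calc 3 * κ / 4 * x⁻¹ = 3 * κ / 4 * (x ^ 2)⁻¹ * x := by field_simp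
        _ ≤ f x := h8
    have hint : IntegrableOn (fun x : ℝ => (3 * κ / 4) * x⁻¹) (Ioc 0 (x₁ / 2)) := by
      refine (hi.mono_set (fun x hx => hx.1)).mono' ?_ ?_
      · exact (measurable_inv.const_mul _).aestronglyMeasurable
      · refine (ae_restrict_iff' measurableSet_Ioc).2 (Eventually.of_forall fun x hx => ?_)
        rw [Real.norm_of_nonneg (mul_nonneg (by linarith) (inv_nonneg.2 hx.1.le))]
        exact hlow x hx
    have hint2 : IntervalIntegrable (fun x : ℝ => x⁻¹) volume 0 (x₁ / 2) := by
      rw [intervalIntegrable_iff_integrableOn_Ioc_of_le (by linarith)]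
      have := hint.const_mul (3 * κ / 4)⁻¹
      refine this.congr (Eventually.of_forall fun x => ?_)
      simp only
      rw [← mul_assoc, inv_mul_cancel₀ (by linarith), one_mul]
    rw [intervalIntegrable_inv_iff] at hint2
    rcases hint2 with h9 | h9
    · linarith
    · exact h9 left_mem_uIcc
  have hfm : MonotoneOn (fun x => f x / x) (Ioi 0) := by
    refine monotoneOn_of_hasDerivWithinAt_nonneg (convex_Ioi 0) (hcont hq)
      (f' := fun x => h x / x ^ 3) ?_ ?_
    · intro x hx
      rw [interior_Ioi] at hx
      exact (hq x hx).hasDerivWithinAt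
    · intro x hx
      rw [interior_Ioi] at hx
      exact div_nonneg (hnonneg x hx) (pow_nonneg (le_of_lt hx) 3)
  by_contra hne
  have hf0 : 0 < f x₀ := by
    have : 0 < ‖v x₀‖ := norm_pos_iff.2 hne
    positivity
  -- Monotonicity of f/x keeps f above f(x₀) to the right of x₀, which contradicts integrability at
  -- infinity.
  have hint : IntegrableOn (fun _ : ℝ => f x₀) (Ioi x₀) := by
    refine (hi.mono_set (Ioi_subset_Ioi hx₀.le)).mono' aestronglyMeasurable_const ?_
    refine (ae_restrict_iff' measurableSet_Ioi).2 (Eventually.of_forall fun x hx => ?_)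
    have hx' : x₀ < x := hx
    rw [Real.norm_of_nonneg hf0.le]
    have h10 := hfm hx₀ (hx₀.trans hx') hx'.le
    simp only at h10
    rw [div_le_div_iff₀ hx₀ (hx₀.trans hx')] at h10
    change f x₀ ≤ f x
    have h11 : f x₀ * x₀ ≤ f x₀ * x := mul_le_mul_of_nonneg_left hx'.le hf0.le
    exact le_of_mul_le_mul_right (h11.trans h10) hx₀
  rw [integrableOn_const_iff] at hint
  rcases hint with h12 | h12
  · exact hf0.ne' (by simpa using h12)
  · simp at h12

end HalfLine

end

/-! ### Smooth functions on the half-cylinder and Green's formula -/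

noncomputable section

namespace GrushinCylinder

/-- Smoothness on the open half-cylinder. -/
def SmoothOnHalf (u : Cyl → ℂ) : Prop := ContDiffOn ℝ ∞ (lift u) {q : ℝ × ℝ | 0 < q.1}

theorem isOpen_halfPlane : IsOpen {q : ℝ × ℝ | 0 < q.1} :=
  isOpen_lt continuous_const continuous_fst

theorem smoothOnHalf_of_mem {u : Cyl → ℂ} (hu : u ∈ testFunctions) : SmoothOnHalf u :=
  hu.1.contDiffOn

theorem smoothOnHalf_of_fst {U : ℝ → ℂ} (hU : ContDiffOn ℝ ∞ U (Ioi 0)) :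
    SmoothOnHalf fun p => U p.1 :=
  hU.comp contDiffOn_fst fun _ hq => hq

namespace SmoothOnHalf

variable {u v : Cyl → ℂ}

theorem contDiffAt (hu : SmoothOnHalf u) {q : ℝ × ℝ} (hq : 0 < q.1) :
    ContDiffAt ℝ ∞ (lift u) q :=
  ContDiffOn.contDiffAt hu (isOpen_halfPlane.mem_nhds hq)

theorem differentiableAt (hu : SmoothOnHalf u) {q : ℝ × ℝ} (hq : 0 < q.1) :
    DifferentiableAt ℝ (lift u) q :=
  (hu.contDiffAt hq).differentiableAt (by simp)

theorem pd (hu : SmoothOnHalf u) (i : Fin 2) : SmoothOnHalf (pd i u) := by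
  have h : ContDiffOn ℝ ∞ (fun q => fderiv ℝ (lift u) q (if i = 0 then (1, 0) else (0, 1)))
      {q : ℝ × ℝ | 0 < q.1} :=
    (ContDiffOn.fderiv_of_isOpen hu isOpen_halfPlane (m := ∞) (by simp)).clm_apply contDiffOn_const
  exact h.congr fun q hq => lift_pd i (hu.differentiableAt hq)

theorem mul (hu : SmoothOnHalf u) (hv : SmoothOnHalf v) : SmoothOnHalf fun p => u p * v p :=
  ContDiffOn.mul hu hv

/-- The behaviour of u as x → 0 is irrelevant: the product vanishes near every point outside the
support of v. -/
theorem mul_mem (hu : SmoothOnHalf u) (hv : v ∈ testFunctions) :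
    (fun p => u p * v p) ∈ testFunctions := by
  have hs : Function.support (fun p : Cyl => u p * v p) ⊆ tsupport v := fun p hp =>
    subset_tsupport v fun h => hp (by simp [h])
  refine ⟨?_, hv.2.1.mono' hs, (closure_minimal hs (isClosed_tsupport v)).trans hv.2.2⟩
  rw [contDiff_iff_contDiffAt]
  intro q
  by_cases hq : 0 < q.1
  · exact (hu.contDiffAt hq).mul hv.1.contDiffAt
  · have hn : ((q.1, (q.2 : AddCircle (2 * Real.pi))) : Cyl) ∉ tsupport v := fun h =>
      hq (hv.2.2 h)
    have h0 := notMem_tsupport_iff_eventuallyEq.1 hn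
    have h1 := isOpenQuotientMap_cover.continuous.continuousAt.eventually h0
    refine (contDiffAt_const (c := (0 : ℂ))).congr_of_eventuallyEq ?_
    filter_upwards [h1] with r hr
    simp only [lift]
    rw [hr]
    simp

/-- Passing to the cover shows that `pd` is a genuine derivative here and not the default value of
`deriv`. -/
theorem hasDerivAt (hu : SmoothOnHalf u) (i : Fin 2) {p : Cyl} (hp : p ∈ halfCyl) :
    HasDerivAt (fun t : ℝ => u (p + coordShift i t)) (GrushinCylinder.pd i u p) 0 := by
  obtain ⟨q, rfl⟩ := isOpenQuotientMap_cover.surjective p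
  have hq : 0 < q.1 := hp
  have h : DifferentiableAt ℝ
      (fun t : ℝ => lift u (q + t • (if i = 0 then (1, 0) else (0, 1)))) 0 := by
    have h1 : DifferentiableAt ℝ (lift u) (q + (0 : ℝ) • (if i = 0 then (1, 0) else (0, 1))) := by
      rw [zero_smul, add_zero]
      exact hu.differentiableAt hq
    exact h1.comp (f := fun t : ℝ => q + t • (if i = 0 then ((1, 0) : ℝ × ℝ) else (0, 1))) 0
      (by fun_prop)
  refine (h.congr_of_eventuallyEq (Eventually.of_forall fun t => ?_)).hasDerivAt
  unfold lift coordShift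
  split_ifs <;> simp

theorem pd_mul (hu : SmoothOnHalf u) (hv : SmoothOnHalf v) (i : Fin 2) {p : Cyl}
    (hp : p ∈ halfCyl) : GrushinCylinder.pd i (fun p => u p * v p) p =
      GrushinCylinder.pd i u p * v p + u p * GrushinCylinder.pd i v p := by
  have h := ((hu.hasDerivAt i hp).fun_mul (hv.hasDerivAt i hp)).deriv
  simp only [coordShift_zero, add_zero] at h
  exact h

theorem pd_sub (hu : SmoothOnHalf u) (hv : SmoothOnHalf v) (i : Fin 2) {p : Cyl}
    (hp : p ∈ halfCyl) : GrushinCylinder.pd i (fun p => u p - v p) p =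
      GrushinCylinder.pd i u p - GrushinCylinder.pd i v p :=
  ((hu.hasDerivAt i hp).sub (hv.hasDerivAt i hp)).deriv

theorem continuousOn (hu : SmoothOnHalf u) : ContinuousOn u halfCyl := by
  intro p hp
  obtain ⟨q, rfl⟩ := isOpenQuotientMap_cover.surjective p
  have h1 : ContinuousAt (lift u) q := (hu.differentiableAt hp).continuousAt
  refine ContinuousAt.continuousWithinAt ?_
  rw [ContinuousAt, ← isOpenQuotientMap_cover.isOpenMap.map_nhds_eq
    isOpenQuotientMap_cover.continuous.continuousAt]
  exact h1

end SmoothOnHalf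

theorem pd_conj (i : Fin 2) (u : Cyl → ℂ) :
    pd i (fun p => starRingEnd ℂ (u p)) = fun p => starRingEnd ℂ (pd i u p) := by
  funext p
  exact deriv.star (f := fun t : ℝ => u (p + coordShift i t))

theorem conj_mem {u : Cyl → ℂ} (hu : u ∈ testFunctions) :
    (fun p => starRingEnd ℂ (u p)) ∈ testFunctions := by
  have hs : Function.support (fun p : Cyl => starRingEnd ℂ (u p)) ⊆ tsupport u := fun p hp =>
    subset_tsupport u fun h => hp (by simp [h])
  exact ⟨Complex.conjCLE.contDiff.comp hu.1, hu.2.1.mono' hs,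
    (closure_minimal hs (isClosed_tsupport u)).trans hu.2.2⟩

/-! ### Integration over the cylinder -/

theorem integrable_of_mem {u : Cyl → ℂ} (hu : u ∈ testFunctions) : Integrable u :=
  (testFunctions_continuous hu).integrable_of_hasCompactSupport hu.2.1

theorem hasDerivAt_fst {u : Cyl → ℂ} (hu : u ∈ testFunctions) (x : ℝ)
    (y : AddCircle (2 * Real.pi)) : HasDerivAt (fun s => u (s, y)) (pd 0 u (x, y)) x := by
  obtain ⟨y, rfl⟩ := QuotientAddGroup.mk_surjective y
  have hd : DifferentiableAt ℝ (fun s : ℝ => u (s, (y : AddCircle (2 * Real.pi)))) x := by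
    have h2 : DifferentiableAt ℝ (lift u) (x, y) := hu.1.differentiable (by simp) _
    exact h2.comp (f := fun s : ℝ => (s, y)) x (by fun_prop)
  rw [pd_zero_apply]
  exact hd.hasDerivAt

theorem hasDerivAt_snd {u : Cyl → ℂ} (hu : u ∈ testFunctions) (x y : ℝ) :
    HasDerivAt (fun t : ℝ => u (x, (t : AddCircle (2 * Real.pi))))
      (pd 1 u (x, (y : AddCircle (2 * Real.pi)))) y := by
  have h2 : DifferentiableAt ℝ (lift u) (x, y) := hu.1.differentiable (by simp) _
  have hd : DifferentiableAt ℝ (fun t : ℝ => u (x, (t : AddCircle (2 * Real.pi)))) y :=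
    h2.comp (f := fun t : ℝ => (x, t)) y (by fun_prop)
  have h3 : pd 1 u (x, (y : AddCircle (2 * Real.pi)))
      = deriv (fun t : ℝ => u (x, (t : AddCircle (2 * Real.pi)))) y := by
    have := deriv_comp_const_add (f := fun t : ℝ => u (x, (t : AddCircle (2 * Real.pi)))) y 0
    simpa [pd, coordShift] using this
  rw [h3]
  exact hd.hasDerivAt

theorem hasCompactSupport_slice {u : Cyl → ℂ} (hu : HasCompactSupport u)
    (y : AddCircle (2 * Real.pi)) : HasCompactSupport fun s => u (s, y) := by
  have hc : IsClosedEmbedding fun s : ℝ => ((s, y) : Cyl) :=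
    Function.LeftInverse.isClosedEmbedding (f := Prod.fst) (fun _ => rfl) continuous_fst
      (by fun_prop)
  exact hu.comp_isClosedEmbedding hc

/-- There are no boundary terms: in x by compact support, in y by periodicity. -/
theorem integral_pd_eq_zero (i : Fin 2) {u : Cyl → ℂ} (hu : u ∈ testFunctions) :
    ∫ p, pd i u p = 0 := by
  fin_cases i
  · change ∫ p, pd 0 u p ∂((volume : Measure ℝ).prod volume) = 0
    rw [integral_prod_symm _ (integrable_of_mem (pd_mem 0 hu))]
    refine integral_eq_zero_of_ae (Eventually.of_forall fun y => ?_)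
    have hint : ∀ v ∈ testFunctions, Integrable fun s : ℝ => v (s, y) := fun v hv =>
      ((testFunctions_continuous hv).comp (by fun_prop :
        Continuous fun s : ℝ => ((s, y) : Cyl))).integrable_of_hasCompactSupport
          (hasCompactSupport_slice hv.2.1 y)
    exact integral_eq_zero_of_hasDerivAt_of_integrable (fun x => hasDerivAt_fst hu x y)
      (hint _ (pd_mem 0 hu)) (hint _ hu)
  · change ∫ p, pd 1 u p ∂((volume : Measure ℝ).prod volume) = 0
    rw [integral_prod _ (integrable_of_mem (pd_mem 1 hu))]
    refine integral_eq_zero_of_ae (Eventually.of_forall fun x => ?_)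
    change ∫ y, pd 1 u (x, y) = 0
    rw [← AddCircle.intervalIntegral_preimage (2 * Real.pi) 0]
    have hc : Continuous fun t : ℝ => pd 1 u (x, (t : AddCircle (2 * Real.pi))) :=
      (testFunctions_continuous (pd_mem 1 hu)).comp
        (continuous_const.prodMk (AddCircle.continuous_mk' _))
    rw [intervalIntegral.integral_eq_sub_of_hasDerivAt (fun t _ => hasDerivAt_snd hu x t)
      (hc.intervalIntegrable _ _)]
    have h0 : ((0 + 2 * Real.pi : ℝ) : AddCircle (2 * Real.pi)) = ((0 : ℝ) : AddCircle _) := by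
      rw [zero_add, AddCircle.coe_period]
      rfl
    rw [h0, sub_self]

theorem measurable_weight (α : ℝ) : Measurable fun p : Cyl => ENNReal.ofReal (p.1 ^ (-α)) := by
  fun_prop

theorem volume_restrict_halfCyl : (volume : Measure Cyl).restrict halfCyl =
    ((volume : Measure ℝ).restrict (Ioi 0)).prod (volume : Measure (AddCircle (2 * Real.pi))) := by
  have : halfCyl = Ioi (0 : ℝ) ×ˢ (univ : Set (AddCircle (2 * Real.pi))) := by
    ext p; simp [halfCyl]
  rw [this, ← Measure.restrict_univ (μ := (volume : Measure (AddCircle (2 * Real.pi)))),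
    Measure.prod_restrict]
  rfl

theorem integral_grushinMeasure {E : Type*} [NormedAddCommGroup E] [NormedSpace ℝ E] (α : ℝ)
    (h : Cyl → E) :
    ∫ p, h p ∂(grushinMeasure α) = ∫ p in halfCyl, p.1 ^ (-α) • h p := by
  rw [grushinMeasure, integral_withDensity_eq_integral_toReal_smul (measurable_weight α)
    (Eventually.of_forall fun _ => ENNReal.ofReal_lt_top)]
  refine setIntegral_congr_fun isOpen_halfCyl.measurableSet fun p hp => ?_
  rw [ENNReal.toReal_ofReal (Real.rpow_nonneg (le_of_lt hp) _)]

theorem integrable_grushinMeasure_iff {E : Type*} [NormedAddCommGroup E] [NormedSpace ℝ E] (α : ℝ)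
    (h : Cyl → E) :
    Integrable h (grushinMeasure α) ↔ IntegrableOn (fun p => p.1 ^ (-α) • h p) halfCyl := by
  rw [grushinMeasure, integrable_withDensity_iff_integrable_smul' (measurable_weight α)
    (Eventually.of_forall fun _ => ENNReal.ofReal_lt_top)]
  refine integrableOn_congr_fun (fun p hp => ?_) isOpen_halfCyl.measurableSet
  rw [ENNReal.toReal_ofReal (Real.rpow_nonneg (le_of_lt hp) _)]

theorem ae_mem_halfCyl (α : ℝ) : ∀ᵐ p ∂(grushinMeasure α), p ∈ halfCyl :=
  (withDensity_absolutelyContinuous _ _).ae_le (ae_restrict_mem isOpen_halfCyl.measurableSet)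

/-! ### Green's formula -/

/-- The expression of `-Δ_α + c K_α` in coordinates. -/
def coordExpr (α c : ℝ) (u : Cyl → ℂ) (p : Cyl) : ℂ :=
  (-1 : ℂ) • pd 0 (pd 0 u) p + (-p.1 ^ (2 * α)) • pd 1 (pd 1 u) p + (α / p.1) • pd 0 u p
    + (c * (-(α * (α + 1)) / p.1 ^ 2)) • u p

theorem coordExpr_conj (α c : ℝ) (u : Cyl → ℂ) (p : Cyl) :
    coordExpr α c (fun p => starRingEnd ℂ (u p)) p = starRingEnd ℂ (coordExpr α c u p) := by
  simp [coordExpr, pd_conj]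

theorem smoothOnHalf_rpow (s : ℝ) : SmoothOnHalf fun p => ((p.1 ^ s : ℝ) : ℂ) :=
  smoothOnHalf_of_fst (U := fun x => ((x ^ s : ℝ) : ℂ))
    (Complex.ofRealCLM.contDiff.comp_contDiffOn fun _ hx =>
      (Real.contDiffAt_rpow_const_of_ne (ne_of_gt hx)).contDiffWithinAt)

/-- The weight puts the operator in divergence form: x^{-α}(-u_xx + (α/x) u_x) = -(x^{-α} u_x)_x and
x^{-α} x^{2α} = x^α. The curvature term is a multiplication and cancels. -/
theorem green_pointwise (α c : ℝ) {u φ : Cyl → ℂ} (hu : SmoothOnHalf u) (hφ : SmoothOnHalf φ)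
    {p : Cyl} (hp : p ∈ halfCyl) :
    p.1 ^ (-α) • (coordExpr α c u p * φ p - u p * coordExpr α c φ p) =
      -(pd 0 (fun p => ((p.1 ^ (-α) : ℝ) : ℂ) * (pd 0 u p * φ p - u p * pd 0 φ p)) p)
      - pd 1 (fun p => ((p.1 ^ α : ℝ) : ℂ) * (pd 1 u p * φ p - u p * pd 1 φ p)) p := by
  have hx : 0 < p.1 := hp
  have hflux : ∀ i, SmoothOnHalf fun p => pd i u p * φ p - u p * pd i φ p := fun i =>
    ContDiffOn.sub ((hu.pd i).mul hφ) (hu.mul (hφ.pd i))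
  have hpd : ∀ i, pd i (fun p => pd i u p * φ p - u p * pd i φ p) p =
      pd i (pd i u) p * φ p - u p * pd i (pd i φ) p := by
    intro i
    rw [((hu.pd i).mul hφ).pd_sub (hu.mul (hφ.pd i)) i hp, (hu.pd i).pd_mul hφ i hp,
      hu.pd_mul (hφ.pd i) i hp]
    ring
  have h0 : pd 0 (fun p : Cyl => ((p.1 ^ (-α) : ℝ) : ℂ)) p
      = ((-α * p.1 ^ (-α - 1) : ℝ) : ℂ) := by
    obtain ⟨x, y⟩ := p
    rw [pd_zero_apply]
    exact (Real.hasDerivAt_rpow_const (Or.inl hx.ne')).ofReal_comp.deriv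
  have h1 : pd 1 (fun p : Cyl => ((p.1 ^ α : ℝ) : ℂ)) p = 0 :=
    pd_one_of_fst (fun x : ℝ => ((x ^ α : ℝ) : ℂ)) p
  rw [(smoothOnHalf_rpow (-α)).pd_mul (hflux 0) 0 hp, (smoothOnHalf_rpow α).pd_mul (hflux 1) 1 hp,
    hpd, hpd, h0, h1]
  have e1 : p.1 ^ (-α) * p.1 ^ (2 * α) = p.1 ^ α := by
    rw [← Real.rpow_add hx]; congr 1; ring
  have e2 : p.1 ^ (-α - 1) = p.1 ^ (-α) * p.1⁻¹ := by
    rw [Real.rpow_sub hx, Real.rpow_one, div_eq_mul_inv]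
  rw [← e1, e2]
  simp only [coordExpr, Complex.real_smul, smul_eq_mul]
  push_cast
  ring

/-- Both fluxes carry a factor φ or a derivative of φ, so they are test functions and their
derivatives integrate to zero. -/
theorem integral_green (α c : ℝ) {u φ : Cyl → ℂ} (hu : SmoothOnHalf u) (hφ : φ ∈ testFunctions) :
    ∫ p, (coordExpr α c u p * φ p - u p * coordExpr α c φ p) ∂(grushinMeasure α) = 0 := by
  have hφs := smoothOnHalf_of_mem hφ
  have hmem : ∀ (i : Fin 2) (s : ℝ),
      (fun p : Cyl => ((p.1 ^ s : ℝ) : ℂ) * (pd i u p * φ p - u p * pd i φ p)) ∈ testFunctions :=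
    fun i s => (smoothOnHalf_rpow s).mul_mem
      (testFunctions.sub_mem ((hu.pd i).mul_mem hφ) (hu.mul_mem (pd_mem i hφ)))
  rw [integral_grushinMeasure, setIntegral_congr_fun isOpen_halfCyl.measurableSet
    fun p hp => green_pointwise α c hu hφs hp]
  have m0 := pd_mem 0 (hmem 0 (-α))
  have m1 := pd_mem 1 (hmem 1 α)
  rw [setIntegral_eq_integral_of_forall_compl_eq_zero, integral_sub (integrable_of_mem m0).fun_neg
    (integrable_of_mem m1), integral_neg, integral_pd_eq_zero 0 (hmem 0 (-α)),
    integral_pd_eq_zero 1 (hmem 1 α)]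
  · simp
  · intro p hp
    rw [image_eq_zero_of_notMem_tsupport fun h => hp (m0.2.2 h),
      image_eq_zero_of_notMem_tsupport fun h => hp (m1.2.2 h)]
    simp

theorem curvatureMap_apply (α c : ℝ) (u : testFunctions) (p : Cyl) :
    (curvatureMap α c u).1 p = coordExpr α c u.1 p :=
  congrFun (curvatureExpr_eq α c u.2) p

theorem inner_toL2 (α : ℝ) (φ : testFunctions) (v : Lp ℂ 2 (grushinMeasure α)) :
    inner ℂ (toL2 α φ) v = ∫ p, v p * starRingEnd ℂ (φ.1 p) ∂(grushinMeasure α) := by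
  rw [L2.inner_def]
  refine integral_congr_ae ?_
  filter_upwards [(testFunctions_memLp α φ.2).coeFn_toLp] with p hp
  change inner ℂ ((testFunctions_memLp α φ.2).toLp φ.1 p) (v p) = _
  rw [hp]
  simp

theorem integrable_inner_toL2 (α : ℝ) (φ : testFunctions) (v : Lp ℂ 2 (grushinMeasure α)) :
    Integrable (fun p => v p * starRingEnd ℂ (φ.1 p)) (grushinMeasure α) := by
  refine (L2.integrable_inner (𝕜 := ℂ) (toL2 α φ) v).congr ?_
  filter_upwards [(testFunctions_memLp α φ.2).coeFn_toLp] with p hp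
  change inner ℂ ((testFunctions_memLp α φ.2).toLp φ.1 p) (v p) = _
  rw [hp]
  simp

theorem exists_testFunction (α c : ℝ) (x : (curvatureLaplacian α c).domain) :
    ∃ φ : testFunctions, (x : Lp ℂ 2 (grushinMeasure α)) = toL2 α φ ∧
      curvatureLaplacian α c x = toL2 α (curvatureMap α c φ) := by
  obtain ⟨x, φ, rfl⟩ := x
  exact ⟨φ, rfl, curvatureLaplacian_apply α c φ⟩

/-- Smooth square-integrable functions whose image is square-integrable lie in the domain of the
adjoint. -/
theorem inner_curvatureLaplacian (α c : ℝ) {u u' : Cyl → ℂ} (hu : SmoothOnHalf u)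
    (hu' : ∀ p ∈ halfCyl, u' p = coordExpr α c u p)
    (hL : MemLp u 2 (grushinMeasure α)) (hL' : MemLp u' 2 (grushinMeasure α))
    (x : (curvatureLaplacian α c).domain) :
    inner ℂ (curvatureLaplacian α c x) (hL.toLp u) =
      inner ℂ (x : Lp ℂ 2 (grushinMeasure α)) (hL'.toLp u') := by
  obtain ⟨φ, h1, h2⟩ := exists_testFunction α c x
  -- Green's formula is bilinear, so it is applied to the conjugate of φ; the coefficients of the
  -- operator are real.
  rw [h1, h2, eq_comm, ← sub_eq_zero, inner_toL2, inner_toL2,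
    ← integral_sub (integrable_inner_toL2 _ _ _) (integrable_inner_toL2 _ _ _),
    ← integral_green α c hu (conj_mem φ.2)]
  refine integral_congr_ae ?_
  filter_upwards [hL.coeFn_toLp, hL'.coeFn_toLp, ae_mem_halfCyl α] with p hp hp' hpm
  rw [hp, hp', hu' p hpm, curvatureMap_apply, coordExpr_conj]

theorem isFormalAdjoint_curvatureLaplacian (α c : ℝ) :
    (curvatureLaplacian α c).IsFormalAdjoint (curvatureLaplacian α c) := by
  intro x y
  obtain ⟨φ, h1, h2⟩ := exists_testFunction α c y
  rw [h1, h2]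
  exact inner_curvatureLaplacian α c (smoothOnHalf_of_mem φ.2)
    (fun p _ => curvatureMap_apply α c φ p) (testFunctions_memLp α φ.2)
    (testFunctions_memLp α (curvatureMap α c φ).2) x

end GrushinCylinder

end

/-! ### Fourier modes, and self-adjointness above the threshold -/

noncomputable section

namespace GrushinCylinder

open HalfLine

/-! ### Separated functions -/

/-- The function `b(x) e^{iky}`. -/
def separated (b : ℝ → ℝ) (k : ℤ) (p : Cyl) : ℂ := (b p.1 : ℂ) * fourier k p.2

theorem separated_mem {b : ℝ → ℝ} (hb : IsTest b) (k : ℤ) : separated b k ∈ testFunctions := by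
  obtain ⟨a, d, ha, -, -, had⟩ := hb.exists_Icc
  have hs : Function.support (separated b k) ⊆
      Icc a d ×ˢ (univ : Set (AddCircle (2 * Real.pi))) := by
    intro p hp
    refine ⟨by_contra fun hn => hp ?_, mem_univ _⟩
    rw [separated, had p.1 fun h => hn ⟨h.1.le, h.2.le⟩]
    simp
  refine ⟨?_, HasCompactSupport.of_support_subset_isCompact (isCompact_Icc.prod isCompact_univ) hs,
    (closure_minimal hs (isClosed_Icc.prod isClosed_univ)).trans fun p hp => ha.trans_le hp.1.1⟩
  have : lift (separated b k) = fun q : ℝ × ℝ => (b q.1 : ℂ) *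
      Complex.exp (2 * Real.pi * Complex.I * k * q.2 / (2 * Real.pi : ℝ)) := by
    funext q
    rw [lift, separated, fourier_coe_apply]
  rw [this]
  have h1 : ContDiff ℝ ∞ fun q : ℝ × ℝ => (b q.1 : ℂ) :=
    Complex.ofRealCLM.contDiff.comp (hb.contDiff.comp contDiff_fst)
  have h2 : ContDiff ℝ ∞ fun q : ℝ × ℝ => (q.2 : ℂ) :=
    Complex.ofRealCLM.contDiff.comp contDiff_snd
  exact h1.mul ((contDiff_const.mul h2).div_const _).cexp

theorem pd_zero_separated {b : ℝ → ℝ} (hb : Differentiable ℝ b) (k : ℤ) :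
    pd 0 (separated b k) = separated (deriv b) k := by
  funext ⟨x, y⟩
  rw [pd_zero_apply]
  exact ((hb x).hasDerivAt.ofReal_comp.mul_const (fourier k y : ℂ)).deriv

theorem pd_one_separated (b : ℝ → ℝ) (k : ℤ) :
    pd 1 (separated b k) = (Complex.I * k) • separated b k := by
  funext ⟨x, y⟩
  obtain ⟨y, rfl⟩ := QuotientAddGroup.mk_surjective y
  have h := hasDerivAt_fourier (2 * Real.pi) k (y + 0)
  have h2 := ((h.comp_const_add y 0).const_mul (b x : ℂ)).deriv
  have h3 : 2 * (Real.pi : ℂ) * Complex.I * k / ((2 * Real.pi : ℝ) : ℂ) = Complex.I * k := by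
    have : (Real.pi : ℂ) ≠ 0 := Complex.ofReal_ne_zero.2 Real.pi_ne_zero
    push_cast
    field_simp
  rw [h3, add_zero] at h2
  have h4 : pd 1 (separated b k) (x, (y : AddCircle (2 * Real.pi))) =
      deriv (fun t : ℝ => (b x : ℂ) * fourier k ((y + t : ℝ) : AddCircle (2 * Real.pi))) 0 := by
    simp [pd, separated, coordShift, -fourier_apply]
  rw [Pi.smul_apply, smul_eq_mul]
  refine h4.trans (h2.trans ?_)
  simp only [separated]
  ring

theorem isTest_rpow_mul (s : ℝ) {g : ℝ → ℝ} (hg : IsTest g) : IsTest fun x => x ^ s * g x := by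
  obtain ⟨a, b, ha, -, -, hab⟩ := hg.exists_Icc
  refine isTest_of_forall (a := a) (b := b) ?_ ha fun x hx => ?_
  · rw [contDiff_iff_contDiffAt]
    intro x
    by_cases hx : 0 < x
    · exact (Real.contDiffAt_rpow_const_of_ne hx.ne').mul hg.contDiff.contDiffAt
    · refine (contDiffAt_const (c := (0 : ℝ))).congr_of_eventuallyEq ?_
      filter_upwards [Iio_mem_nhds (lt_of_le_of_lt (not_lt.1 hx) ha)] with y hy
      rw [hab y fun h => lt_asymm h.1 hy, mul_zero]
  · rw [hab x fun h => hx ⟨h.1.le, h.2.le⟩, mul_zero]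

/-- Conjugation by `x^{α/2}` removes the first order term. -/
theorem conjugated_radial (α κ : ℝ) {g : ℝ → ℝ} (hg : IsTest g) {x : ℝ} (hx : 0 < x) :
    -deriv (deriv fun x => x ^ (α / 2) * g x) x
      + α / x * deriv (fun x => x ^ (α / 2) * g x) x - κ / x ^ 2 * (x ^ (α / 2) * g x)
    = x ^ (α / 2) * (-deriv (deriv g) x + (α ^ 2 / 4 + α / 2 - κ) / x ^ 2 * g x) := by
  have hr : ∀ s y : ℝ, 0 < y → HasDerivAt (fun x : ℝ => x ^ s) (s * y ^ (s - 1)) y :=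
    fun s y hy => Real.hasDerivAt_rpow_const (Or.inl hy.ne')
  have h1 : ∀ y, 0 < y → HasDerivAt (fun x => x ^ (α / 2) * g x)
      (α / 2 * y ^ (α / 2 - 1) * g y + y ^ (α / 2) * deriv g y) y := fun y hy =>
    (hr _ y hy).mul (hg.differentiable y).hasDerivAt
  have h2 : deriv (fun x => x ^ (α / 2) * g x) =ᶠ[𝓝 x]
      fun y => α / 2 * y ^ (α / 2 - 1) * g y + y ^ (α / 2) * deriv g y := by
    filter_upwards [Ioi_mem_nhds hx] with y hy using (h1 y hy).deriv
  have h3 := ((((hr (α / 2 - 1) x hx).const_mul (α / 2)).mul (hg.differentiable x).hasDerivAt).add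
    ((hr (α / 2) x hx).mul (hg.deriv.differentiable x).hasDerivAt)).deriv
  rw [h2.deriv_eq, (h1 x hx).deriv]
  refine (congrArg (fun z => -z + _ - _) h3).trans ?_
  rw [Real.rpow_sub hx (α / 2 - 1), Real.rpow_sub hx (α / 2), Real.rpow_one]
  field_simp
  ring

/-- The reduction to a half-line Schrödinger operator: conjugation by x^{α/2} shifts the
inverse-square coefficient by α²/4 + α/2, and -∂_y² acts on the mode as k². -/
theorem coordExpr_separated (α c : ℝ) (k : ℤ) {g : ℝ → ℝ} (hg : IsTest g) {p : Cyl}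
    (hp : p ∈ halfCyl) :
    coordExpr α c (separated (fun x => x ^ (α / 2) * g x) k) p =
      ((p.1 ^ (α / 2) * (-deriv (deriv g) p.1 + ((α ^ 2 / 4 + α / 2 - c * (α * (α + 1))) / p.1 ^ 2
        + k ^ 2 * p.1 ^ (2 * α)) * g p.1) : ℝ) : ℂ) * fourier k p.2 := by
  have hb := isTest_rpow_mul (α / 2) hg
  rw [coordExpr, pd_one_separated, pd_smul, pd_one_separated, pd_zero_separated hb.differentiable,
    pd_zero_separated hb.deriv.differentiable]
  have h := conjugated_radial α (c * (α * (α + 1))) hg hp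
  have h2 : p.1 ^ (α / 2) * (-deriv (deriv g) p.1 + ((α ^ 2 / 4 + α / 2 - c * (α * (α + 1)))
      / p.1 ^ 2 + k ^ 2 * p.1 ^ (2 * α)) * g p.1)
      = -deriv (deriv fun x => x ^ (α / 2) * g x) p.1
      + α / p.1 * deriv (fun x => x ^ (α / 2) * g x) p.1
      - (c * (α * (α + 1))) / p.1 ^ 2 * (p.1 ^ (α / 2) * g p.1)
      + k ^ 2 * p.1 ^ (2 * α) * (p.1 ^ (α / 2) * g p.1) := by
    rw [h]; ring
  rw [h2]
  simp only [separated, Pi.smul_apply, smul_eq_mul, Complex.real_smul]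
  push_cast
  linear_combination (-(p.1 ^ (2 * α) : ℝ) * k ^ 2 * ((p.1 ^ (α / 2) : ℝ) * g p.1)
    * fourier k p.2 : ℂ) * Complex.I_sq

/-! ### Fourier coefficients in the angular variable -/

theorem hasSum_sq_fourierCoeff_of_memLp {f : AddCircle (2 * Real.pi) → ℂ}
    (hf : MemLp f 2 AddCircle.haarAddCircle) :
    HasSum (fun k => ‖fourierCoeff f k‖ ^ 2) (∫ t, ‖f t‖ ^ 2 ∂AddCircle.haarAddCircle) := by
  have h := hasSum_sq_fourierCoeff hf.toLp
  rw [fourierCoeff_congr_ae hf.coeFn_toLp] at h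
  convert h using 1
  refine integral_congr_ae ?_
  filter_upwards [hf.coeFn_toLp] with t ht
  rw [ht]

/-- The Fourier coefficients of `x^{-α/2} v` in the angular variable. -/
def angularCoeff (α : ℝ) (v : Cyl → ℂ) (k : ℤ) (x : ℝ) : ℂ :=
  fourierCoeff (fun y => ((x ^ (-(α / 2)) : ℝ) : ℂ) * v (x, y)) k

/-- Testing against x^{α/2} g(x) e^{iky} and integrating over y first leaves the weak form of w'' =
(V + z̄) w for the k-th coefficient. -/
theorem weak_angularCoeff (α c : ℝ) (z : ℂ) (v : Lp ℂ 2 (grushinMeasure α))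
    (hv : ∀ φ : testFunctions,
      ∫ p, v p * starRingEnd ℂ (coordExpr α c φ.1 p + z * φ.1 p) ∂(grushinMeasure α) = 0)
    (k : ℤ) {g : ℝ → ℝ} (hg : IsTest g) :
    ∫ x in Ioi 0, (deriv (deriv g) x • angularCoeff α v k x - g x •
      (((((α ^ 2 / 4 + α / 2 - c * (α * (α + 1))) / x ^ 2 + k ^ 2 * x ^ (2 * α) : ℝ) : ℂ)
        + starRingEnd ℂ z) * angularCoeff α v k x)) = 0 := by
  set V : ℝ → ℝ := fun x => (α ^ 2 / 4 + α / 2 - c * (α * (α + 1))) / x ^ 2 + k ^ 2 * x ^ (2 * α)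
    with hV
  let φ : testFunctions := ⟨separated (fun x => x ^ (α / 2) * g x) k,
    separated_mem (isTest_rpow_mul _ hg) k⟩
  set m : ℝ → ℂ := fun x => -((deriv (deriv g) x : ℝ) : ℂ)
    + ((V x : ℂ) + starRingEnd ℂ z) * g x with hm
  have hpt : ∀ p ∈ halfCyl,
      p.1 ^ (-α) • (v p * starRingEnd ℂ (coordExpr α c φ.1 p + z * φ.1 p)) =
      m p.1 * (fourier (-k) p.2 • (((p.1 ^ (-(α / 2)) : ℝ) : ℂ) * v p)) := by
    intro p hp
    have hx : 0 < p.1 := hp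
    have e : p.1 ^ (-(α / 2)) = p.1 ^ (-α) * p.1 ^ (α / 2) := by
      rw [← Real.rpow_add hx]; congr 1; ring
    rw [coordExpr_separated α c k hg hp, e, fourier_neg]
    simp only [φ, separated, hm, hV, map_add, map_mul, Complex.conj_ofReal, Complex.real_smul,
      smul_eq_mul]
    push_cast
    ring
  have hint : Integrable (fun p => m p.1 * (fourier (-k) p.2 •
      (((p.1 ^ (-(α / 2)) : ℝ) : ℂ) * v p))) (volume.restrict halfCyl) := by
    have h1 := (integrable_inner_toL2 α (curvatureMap α c φ) v).add
      (integrable_inner_toL2 α (z • φ) v)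
    have h2 := (integrable_grushinMeasure_iff α _).1 h1
    refine (integrableOn_congr_fun (fun p hp => ?_) isOpen_halfCyl.measurableSet).1 h2
    rw [← hpt p hp]
    simp only [Pi.add_apply, curvatureMap_apply]
    rw [map_add, mul_add]
    rfl
  have h3 := hv φ
  rw [integral_grushinMeasure, setIntegral_congr_fun isOpen_halfCyl.measurableSet hpt] at h3
  rw [volume_restrict_halfCyl] at h3 hint
  rw [integral_prod _ hint] at h3
  have hT : (2 * Real.pi) ≠ 0 := Real.two_pi_pos.ne'
  -- Fourier coefficients use the normalized Haar measure, hence the factor 2π.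
  have h4 : ∀ x : ℝ, ∫ y : AddCircle (2 * Real.pi), m x * (fourier (-k) y •
      (((x ^ (-(α / 2)) : ℝ) : ℂ) * v (x, y)))
      = (2 * Real.pi) • (m x * angularCoeff α v k x) := by
    intro x
    rw [integral_const_mul, angularCoeff, fourierCoeff, AddCircle.integral_haarAddCircle,
      mul_smul_comm, smul_smul, mul_inv_cancel₀ hT, one_smul]
  simp only [h4] at h3
  rw [integral_smul, smul_eq_zero_iff_right hT] at h3
  rw [← neg_eq_zero, ← integral_neg, ← h3]
  congr 1
  funext x
  simp only [hm, Complex.real_smul]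
  ring

theorem integrable_sq_weighted (α : ℝ) (v : Lp ℂ 2 (grushinMeasure α)) :
    Integrable (fun p : Cyl => ‖((p.1 ^ (-(α / 2)) : ℝ) : ℂ) * v p‖ ^ 2)
      (volume.restrict halfCyl) := by
  have h1 := (memLp_two_iff_integrable_sq_norm (Lp.aestronglyMeasurable v)).1 (Lp.memLp v)
  rw [integrable_grushinMeasure_iff] at h1
  refine (integrableOn_congr_fun (fun p hp => ?_) isOpen_halfCyl.measurableSet).1 h1
  have hx : 0 < p.1 := hp
  have e : (p.1 ^ (-(α / 2))) ^ 2 = p.1 ^ (-α) := by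
    rw [← Real.rpow_natCast, ← Real.rpow_mul hx.le]
    congr 1
    push_cast
    ring
  rw [norm_mul, mul_pow, Complex.norm_real, Real.norm_of_nonneg (Real.rpow_nonneg hx.le _), e,
    smul_eq_mul]

theorem stronglyMeasurable_weighted (α : ℝ) (v : Lp ℂ 2 (grushinMeasure α)) :
    StronglyMeasurable fun p : Cyl => ((p.1 ^ (-(α / 2)) : ℝ) : ℂ) * v p := by
  have h : Measurable fun p : Cyl => ((p.1 ^ (-(α / 2)) : ℝ) : ℂ) := by fun_prop
  exact h.stronglyMeasurable.mul (Lp.stronglyMeasurable v)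

theorem stronglyMeasurable_angularCoeff (α : ℝ) (v : Lp ℂ 2 (grushinMeasure α)) (k : ℤ) :
    StronglyMeasurable (angularCoeff α v k) := by
  have h1 : StronglyMeasurable fun p : Cyl => (fourier (-k) p.2 : ℂ) :=
    ((fourier (-k)).continuous.comp continuous_snd).stronglyMeasurable
  exact (h1.mul (stronglyMeasurable_weighted α v)).integral_prod_right'
    (ν := AddCircle.haarAddCircle)

theorem integrable_sliceNorm (α : ℝ) (v : Lp ℂ 2 (grushinMeasure α)) :
    IntegrableOn (fun x : ℝ => ∫ y, ‖((x ^ (-(α / 2)) : ℝ) : ℂ) * v (x, y)‖ ^ 2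
      ∂(AddCircle.haarAddCircle (T := 2 * Real.pi))) (Ioi 0) := by
  have h := integrable_sq_weighted α v
  rw [volume_restrict_halfCyl] at h
  have h2 := h.integral_prod_left.smul (2 * Real.pi)⁻¹
  refine h2.congr (Eventually.of_forall fun x => ?_)
  simp only [Pi.smul_apply, AddCircle.integral_haarAddCircle]

/-- Parseval on each slice; by Fubini almost every slice is square-integrable. -/
theorem ae_hasSum_angularCoeff (α : ℝ) (v : Lp ℂ 2 (grushinMeasure α)) :
    ∀ᵐ x ∂(volume.restrict (Ioi (0 : ℝ))), HasSum (fun k => ‖angularCoeff α v k x‖ ^ 2)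
      (∫ y, ‖((x ^ (-(α / 2)) : ℝ) : ℂ) * v (x, y)‖ ^ 2
        ∂(AddCircle.haarAddCircle (T := 2 * Real.pi))) := by
  have h := integrable_sq_weighted α v
  rw [volume_restrict_halfCyl] at h
  filter_upwards [h.prod_right_ae] with x hx
  have hm : StronglyMeasurable fun y : AddCircle (2 * Real.pi) =>
      ((x ^ (-(α / 2)) : ℝ) : ℂ) * v (x, y) :=
    (stronglyMeasurable_weighted α v).comp_measurable measurable_prodMk_left
  have hmem : MemLp (fun y : AddCircle (2 * Real.pi) => ((x ^ (-(α / 2)) : ℝ) : ℂ) * v (x, y)) 2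
      volume := (memLp_two_iff_integrable_sq_norm hm.aestronglyMeasurable).2 hx
  exact hasSum_sq_fourierCoeff_of_memLp hmem.haarAddCircle

theorem integrable_sq_angularCoeff (α : ℝ) (v : Lp ℂ 2 (grushinMeasure α)) (k : ℤ) :
    IntegrableOn (fun x => ‖angularCoeff α v k x‖ ^ 2) (Ioi 0) := by
  refine (integrable_sliceNorm α v).mono'
    ((stronglyMeasurable_angularCoeff α v k).norm.pow 2).aestronglyMeasurable ?_
  filter_upwards [ae_hasSum_angularCoeff α v] with x hx
  rw [Real.norm_of_nonneg (sq_nonneg _)]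
  exact le_hasSum hx k fun _ _ => sq_nonneg _

theorem eq_zero_of_angularCoeff (α : ℝ) (v : Lp ℂ 2 (grushinMeasure α))
    (h : ∀ k, ∀ᵐ x ∂(volume.restrict (Ioi (0 : ℝ))), angularCoeff α v k x = 0) : v = 0 := by
  have h1 : ∀ᵐ x ∂(volume.restrict (Ioi (0 : ℝ))),
      ∫ y : AddCircle (2 * Real.pi), ‖((x ^ (-(α / 2)) : ℝ) : ℂ) * v (x, y)‖ ^ 2 = 0 := by
    filter_upwards [ae_all_iff.2 h, ae_hasSum_angularCoeff α v] with x hx hs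
    have h0 : HasSum (fun k => ‖angularCoeff α v k x‖ ^ 2) 0 := by
      simp only [hx, norm_zero, ne_eq, OfNat.ofNat_ne_zero, not_false_eq_true, zero_pow]
      exact hasSum_zero
    have h2 := hs.unique h0
    rw [AddCircle.integral_haarAddCircle] at h2
    exact (smul_eq_zero_iff_right (inv_ne_zero Real.two_pi_pos.ne')).1 h2
  have hint := integrable_sq_weighted α v
  have h2 : ∫ p in halfCyl, ‖((p.1 ^ (-(α / 2)) : ℝ) : ℂ) * v p‖ ^ 2 = 0 := by
    rw [volume_restrict_halfCyl] at hint ⊢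
    rw [integral_prod _ hint]
    exact integral_eq_zero_of_ae h1
  rw [integral_eq_zero_iff_of_nonneg (fun _ => sq_nonneg _) hint] at h2
  rw [Lp.eq_zero_iff_ae_eq_zero]
  refine (withDensity_absolutelyContinuous _ _).ae_le ?_
  filter_upwards [h2, ae_restrict_mem isOpen_halfCyl.measurableSet] with p hp hpm
  have hx : 0 < p.1 := hpm
  have h3 := norm_eq_zero.1 (pow_eq_zero_iff (two_ne_zero) |>.1 hp)
  exact (mul_eq_zero.1 h3).resolve_left
    (Complex.ofReal_ne_zero.2 (Real.rpow_pos_of_pos hx _).ne')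

/-- If the singular potential is at least `3 / (4 x²)`, the deficiency spaces are trivial. -/
theorem eq_zero_of_deficiency {α c : ℝ} (h : 3 / 4 ≤ α ^ 2 / 4 + α / 2 - c * (α * (α + 1)))
    {z : ℂ} (hz : z.re = 0) (v : Lp ℂ 2 (grushinMeasure α))
    (hv : ∀ φ : testFunctions,
      ∫ p, v p * starRingEnd ℂ (coordExpr α c φ.1 p + z * φ.1 p) ∂(grushinMeasure α) = 0) :
    v = 0 := by
  refine eq_zero_of_angularCoeff α v fun k => ?_
  set W : ℝ → ℂ := fun x => (((α ^ 2 / 4 + α / 2 - c * (α * (α + 1))) / x ^ 2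
    + k ^ 2 * x ^ (2 * α) : ℝ) : ℂ) + starRingEnd ℂ z with hW
  have hWc : ContinuousOn W (Ioi 0) := by
    refine ContinuousOn.add (Complex.continuous_ofReal.comp_continuousOn (ContinuousOn.add ?_ ?_))
      continuousOn_const
    · exact continuousOn_const.div (by fun_prop) fun x hx => pow_ne_zero 2 (ne_of_gt hx)
    · exact continuousOn_const.mul (continuousOn_id.rpow_const fun x hx => Or.inl (ne_of_gt hx))
  -- The term k² x^{2α} only helps and z has no real part, so one bound serves all modes.
  have hWre : ∀ x, 0 < x → 3 / (4 * x ^ 2) ≤ (W x).re := by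
    intro x hx
    simp only [hW, Complex.add_re, Complex.ofReal_re, Complex.conj_re, hz, add_zero]
    have h1 : 0 ≤ (k : ℝ) ^ 2 * x ^ (2 * α) := mul_nonneg (sq_nonneg _) (Real.rpow_nonneg hx.le _)
    have h2 : 3 / (4 * x ^ 2) ≤ (α ^ 2 / 4 + α / 2 - c * (α * (α + 1))) / x ^ 2 := by
      rw [← div_div]
      gcongr
    linarith
  have hsq := integrable_sq_angularCoeff α v k
  have hmeas := (stronglyMeasurable_angularCoeff α v k).aestronglyMeasurable
    (μ := volume.restrict (Ioi 0))
  have hloc : LocallyIntegrableOn (angularCoeff α v k) (Ioi 0) :=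
    locallyIntegrableOn_of_locallyIntegrable_restrict
      (((memLp_two_iff_integrable_sq_norm hmeas).2 hsq).locallyIntegrable (by norm_num))
  obtain ⟨u, u', hu, hu', hae⟩ := exists_classical_solution hWc hloc
    fun g hg => weak_angularCoeff α c z v hv k hg
  rw [← ae_restrict_iff' measurableSet_Ioi] at hae
  have husq : IntegrableOn (fun x => ‖u x‖ ^ 2) (Ioi 0) := by
    refine hsq.congr ?_
    filter_upwards [hae] with x hx
    rw [hx]
  filter_upwards [hae, ae_restrict_mem measurableSet_Ioi] with x hx hx0
  rw [hx]
  exact eq_zero_of_integrable_sq hu hu' hWre husq hx0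

/-- The vanishing result is used with z = i and z = -i, one for each deficiency space. -/
theorem isEssentiallySelfAdjoint_of_le {α c : ℝ}
    (h : 3 / 4 ≤ α ^ 2 / 4 + α / 2 - c * (α * (α + 1))) :
    IsEssentiallySelfAdjoint (curvatureLaplacian α c) := by
  have key : ∀ z : ℂ, z.re = 0 → ∀ v : Lp ℂ 2 (grushinMeasure α),
      (∀ x : (curvatureLaplacian α c).domain,
        inner ℂ (curvatureLaplacian α c x + z • (x : Lp ℂ 2 (grushinMeasure α))) v = 0) →
      v = 0 := by
    intro z hz v hv
    refine eq_zero_of_deficiency h hz v fun φ => ?_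
    have h1 := hv ⟨toL2 α φ, LinearMap.mem_range_self _ φ⟩
    rw [curvatureLaplacian_apply] at h1
    change inner ℂ (toL2 α (curvatureMap α c φ) + z • toL2 α φ) v = 0 at h1
    rw [← map_smul, ← map_add, inner_toL2] at h1
    rw [← h1]
    congr 1
    funext p
    rw [← curvatureMap_apply]
    rfl
  refine LinearPMap.isSelfAdjoint_closure_of_deficiency ?_ (isFormalAdjoint_curvatureLaplacian α c)
    (key _ Complex.I_re) fun v hv => key (-Complex.I) (by simp) v fun x => ?_
  -- Density comes from the same statement: a vector orthogonal to all test functions is orthogonal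
  -- to the range of A + i.
  · rw [Submodule.dense_iff_topologicalClosure_eq_top,
      Submodule.topologicalClosure_eq_top_iff, Submodule.eq_bot_iff]
    intro v hv
    rw [Submodule.mem_orthogonal] at hv
    refine key _ Complex.I_re v fun x => ?_
    obtain ⟨φ, h1, h2⟩ := exists_testFunction α c x
    rw [h1, h2, ← map_smul, ← map_add]
    exact hv _ (LinearMap.mem_range_self _ _)
  · rw [neg_smul, ← sub_eq_add_neg]
    exact hv x

end GrushinCylinder

end

/-! ### Radial functions, and failure below the threshold -/

noncomputable section

namespace GrushinCylinder

/-! ### Radial functions -/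

/-- The radial part of `-Δ_α + c K_α`. -/
def radialExpr (α c : ℝ) (U : ℝ → ℝ) (x : ℝ) : ℝ :=
  -deriv (deriv U) x + α / x * deriv U x - c * (α * (α + 1)) / x ^ 2 * U x

theorem continuousOn_radialExpr (α c : ℝ) {U : ℝ → ℝ} (hU : ContDiffOn ℝ ∞ U (Ioi 0)) :
    ContinuousOn (radialExpr α c U) (Ioi 0) := by
  have hU' := ((contDiffOn_infty_iff_deriv_of_isOpen isOpen_Ioi).1 hU).2
  have hU'' := ((contDiffOn_infty_iff_deriv_of_isOpen isOpen_Ioi).1 hU').2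
  have hne : ∀ x ∈ Ioi (0 : ℝ), x ≠ 0 := fun x hx => ne_of_gt hx
  exact (hU''.continuousOn.neg.add ((continuousOn_const.div continuousOn_id hne).mul
    hU'.continuousOn)).sub ((continuousOn_const.div (continuousOn_id.pow 2)
      fun x hx => pow_ne_zero 2 (hne x hx)).mul hU.continuousOn)

theorem coordExpr_radial (α c : ℝ) {U : ℝ → ℝ} (hU : ContDiffOn ℝ ∞ U (Ioi 0)) {p : Cyl}
    (hp : p ∈ halfCyl) :
    coordExpr α c (fun p => (U p.1 : ℂ)) p = (radialExpr α c U p.1 : ℂ) := by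
  have hU' : ContDiffOn ℝ ∞ (deriv U) (Ioi 0) :=
    ((contDiffOn_infty_iff_deriv_of_isOpen isOpen_Ioi).1 hU).2
  have h0 : ∀ {V : ℝ → ℝ}, ContDiffOn ℝ ∞ V (Ioi 0) → ∀ q ∈ halfCyl,
      pd 0 (fun p : Cyl => (V p.1 : ℂ)) q = ((deriv V q.1 : ℝ) : ℂ) := by
    rintro V hV ⟨x, y⟩ hx
    rw [pd_zero_apply]
    exact ((hV.contDiffAt (Ioi_mem_nhds hx)).differentiableAt
      (by simp)).hasDerivAt.ofReal_comp.deriv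
  have h1 : pd 1 (fun p : Cyl => (U p.1 : ℂ)) = fun _ => 0 :=
    funext fun q => pd_one_of_fst (fun x => (U x : ℂ)) q
  have h00 : pd 0 (pd 0 (fun p : Cyl => (U p.1 : ℂ))) p = ((deriv (deriv U) p.1 : ℝ) : ℂ) := by
    rw [← h0 hU' p hp]
    apply pd_congr
    filter_upwards [isOpen_halfCyl.mem_nhds hp] with q hq using h0 hU q hq
  have h11 : pd 1 (fun _ : Cyl => (0 : ℂ)) p = 0 := by simp [pd]
  rw [coordExpr, h1, h11, h00, h0 hU p hp, radialExpr]
  simp only [Complex.real_smul, smul_eq_mul]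
  push_cast
  ring

theorem memLp_radial {α : ℝ} {U : ℝ → ℝ} (hc : ContinuousOn U (Ioi 0))
    (hi : IntegrableOn (fun x => x ^ (-α) * U x ^ 2) (Ioi 0)) :
    MemLp (fun p : Cyl => (U p.1 : ℂ)) 2 (grushinMeasure α) := by
  have hc2 : ContinuousOn (fun p : Cyl => (U p.1 : ℂ)) halfCyl :=
    Complex.continuous_ofReal.comp_continuousOn (hc.comp continuousOn_fst fun _ hp => hp)
  have hm : AEStronglyMeasurable (fun p : Cyl => (U p.1 : ℂ)) (grushinMeasure α) :=
    (hc2.aestronglyMeasurable isOpen_halfCyl.measurableSet).mono_ac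
      (withDensity_absolutelyContinuous _ _)
  rw [memLp_two_iff_integrable_sq_norm hm, integrable_grushinMeasure_iff, IntegrableOn,
    volume_restrict_halfCyl]
  refine (hi.comp_fst _).congr (Eventually.of_forall fun p => ?_)
  simp [Complex.norm_real, sq_abs]

theorem integral_radial (α : ℝ) (F : ℝ → ℂ) :
    ∫ p : Cyl, F p.1 ∂(grushinMeasure α) =
      (2 * Real.pi) • ∫ x in Ioi 0, x ^ (-α) • F x := by
  rw [integral_grushinMeasure, volume_restrict_halfCyl,
    integral_fun_fst (fun x : ℝ => x ^ (-α) • F x)]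
  simp [Measure.real, AddCircle.measure_univ, Real.pi_nonneg]

/-- If the closure is self-adjoint, the boundary form of two radial functions vanishes. -/
theorem boundary_form_eq_zero {α c : ℝ}
    (h : IsEssentiallySelfAdjoint (curvatureLaplacian α c)) {U V : ℝ → ℝ}
    (hU : ContDiffOn ℝ ∞ U (Ioi 0)) (hV : ContDiffOn ℝ ∞ V (Ioi 0))
    (hUi : IntegrableOn (fun x => x ^ (-α) * U x ^ 2) (Ioi 0))
    (hVi : IntegrableOn (fun x => x ^ (-α) * V x ^ 2) (Ioi 0))
    (hUL : IntegrableOn (fun x => x ^ (-α) * radialExpr α c U x ^ 2) (Ioi 0))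
    (hVL : IntegrableOn (fun x => x ^ (-α) * radialExpr α c V x ^ 2) (Ioi 0)) :
    ∫ x in Ioi 0, x ^ (-α) * (radialExpr α c U x * V x - U x * radialExpr α c V x) = 0 := by
  have sm : ∀ {U : ℝ → ℝ}, ContDiffOn ℝ ∞ U (Ioi 0) → SmoothOnHalf fun p => (U p.1 : ℂ) :=
    fun hU => smoothOnHalf_of_fst (U := fun x => ((_ : ℝ → ℝ) x : ℂ))
      (Complex.ofRealCLM.contDiff.comp_contDiffOn hU)
  have mU := memLp_radial hU.continuousOn hUi
  have mV := memLp_radial hV.continuousOn hVi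
  have mUL := memLp_radial (continuousOn_radialExpr α c hU) hUL
  have mVL := memLp_radial (continuousOn_radialExpr α c hV) hVL
  -- The four integrability conditions place U and V in the domain of the adjoint, which acts on
  -- them by the radial expression.
  have key := LinearPMap.inner_eq_of_isSelfAdjoint_closure h
    (inner_curvatureLaplacian α c (sm hU) (fun p hp => (coordExpr_radial α c hU hp).symm) mU mUL)
    (inner_curvatureLaplacian α c (sm hV) (fun p hp => (coordExpr_radial α c hV hp).symm) mV mVL)
  rw [← sub_eq_zero, L2.inner_def, L2.inner_def,
    ← integral_sub (L2.integrable_inner _ _) (L2.integrable_inner _ _)] at key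
  have e : ∫ p : Cyl, ((radialExpr α c U p.1 * V p.1 - U p.1 * radialExpr α c V p.1 : ℝ) : ℂ)
      ∂(grushinMeasure α) = 0 := by
    rw [← key]
    refine integral_congr_ae ?_
    filter_upwards [mU.coeFn_toLp, mV.coeFn_toLp, mUL.coeFn_toLp, mVL.coeFn_toLp]
      with p h1 h2 h3 h4
    rw [h1, h2, h3, h4]
    simp only [RCLike.inner_apply, Complex.conj_ofReal]
    push_cast
    ring
  rw [integral_radial α (fun x => ((radialExpr α c U x * V x - U x * radialExpr α c V x : ℝ) : ℂ)),
    smul_eq_zero_iff_right Real.two_pi_pos.ne'] at e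
  have e2 : ∀ x : ℝ, x ^ (-α) •
      ((radialExpr α c U x * V x - U x * radialExpr α c V x : ℝ) : ℂ)
      = ((x ^ (-α) * (radialExpr α c U x * V x - U x * radialExpr α c V x) : ℝ) : ℂ) := by
    intro x
    rw [Complex.real_smul, ← Complex.ofReal_mul]
  simp only [e2] at e
  rw [integral_complex_ofReal] at e
  exact Complex.ofReal_eq_zero.1 e

/-- Lagrange's identity. -/
theorem hasDerivAt_boundary (α c : ℝ) {U V : ℝ → ℝ} (hU : ContDiffOn ℝ ∞ U (Ioi 0))
    (hV : ContDiffOn ℝ ∞ V (Ioi 0)) {x : ℝ} (hx : 0 < x) :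
    HasDerivAt (fun x => x ^ (-α) * (U x * deriv V x - deriv U x * V x))
      (x ^ (-α) * (radialExpr α c U x * V x - U x * radialExpr α c V x)) x := by
  have hd : ∀ {U : ℝ → ℝ}, ContDiffOn ℝ ∞ U (Ioi 0) → HasDerivAt U (deriv U x) x := fun hU =>
    ((hU.contDiffAt (Ioi_mem_nhds hx)).differentiableAt (by simp)).hasDerivAt
  have hU' := ((contDiffOn_infty_iff_deriv_of_isOpen isOpen_Ioi).1 hU).2
  have hV' := ((contDiffOn_infty_iff_deriv_of_isOpen isOpen_Ioi).1 hV).2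
  have h := (Real.hasDerivAt_rpow_const (p := -α) (Or.inl hx.ne')).mul
    (((hd hU).mul (hd hV')).sub ((hd hU').mul (hd hV)))
  refine h.congr_deriv ?_
  rw [Real.rpow_sub hx, Real.rpow_one]
  simp only [radialExpr, Pi.sub_apply, Pi.mul_apply]
  field_simp
  ring

/-! ### Solutions near the singularity -/

/-- Two independent solutions of `ψ'' = D ψ`, with a growth bound, for `D < 1`. -/
theorem exists_fundamental_system {D : ℝ} (hD : D < 1) :
    ∃ (ψ₁ ψ₂ : ℝ → ℝ) (K θ b : ℝ), θ < 1 ∧ b ≠ 0 ∧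
      ContDiff ℝ ∞ ψ₁ ∧ ContDiff ℝ ∞ ψ₂ ∧
      (∀ t, deriv (deriv ψ₁) t = D * ψ₁ t) ∧ (∀ t, deriv (deriv ψ₂) t = D * ψ₂ t) ∧
      (∀ t ≤ 0, |ψ₁ t| ≤ K * Real.exp (-(θ * t))) ∧
      (∀ t ≤ 0, |ψ₂ t| ≤ K * Real.exp (-(θ * t))) ∧
      ∀ t, ψ₁ t * deriv ψ₂ t - deriv ψ₁ t * ψ₂ t = b := by
  -- The pairs are cos and sin of σt, then 1 and t, then e^{±σt}. As t → -∞ they are controlled with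
  -- θ = 0, 1/2 and σ = √D respectively; D < 1 is what gives σ < 1 in the last case.
  rcases lt_trichotomy D 0 with h | rfl | h
  · set σ := √(-D) with hσ
    have hσ0 : 0 < σ := Real.sqrt_pos.2 (by linarith)
    have hσ2 : σ ^ 2 = -D := Real.sq_sqrt (by linarith)
    have d1 : deriv (fun t => Real.cos (σ * t)) = fun t => -σ * Real.sin (σ * t) := by
      funext t
      have := ((Real.hasDerivAt_cos (σ * t)).comp t ((hasDerivAt_id t).const_mul σ)).deriv
      refine this.trans ?_
      ring
    have d2 : deriv (fun t => Real.sin (σ * t)) = fun t => σ * Real.cos (σ * t) := by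
      funext t
      have := ((Real.hasDerivAt_sin (σ * t)).comp t ((hasDerivAt_id t).const_mul σ)).deriv
      refine this.trans ?_
      ring
    refine ⟨fun t => Real.cos (σ * t), fun t => Real.sin (σ * t), 1, 0, σ, one_pos, hσ0.ne',
      Real.contDiff_cos.comp (contDiff_const.mul contDiff_id),
      Real.contDiff_sin.comp (contDiff_const.mul contDiff_id), ?_, ?_, ?_, ?_, ?_⟩
    · intro t
      rw [d1, deriv_const_mul_field, d2]
      simp only
      linear_combination (-Real.cos (σ * t)) * hσ2
    · intro t
      rw [d2, deriv_const_mul_field, d1]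
      simp only
      linear_combination (-Real.sin (σ * t)) * hσ2
    · intro t _
      simpa using Real.abs_cos_le_one (σ * t)
    · intro t _
      simpa using Real.abs_sin_le_one (σ * t)
    · intro t
      rw [d1, d2]
      simp only
      linear_combination σ * Real.sin_sq_add_cos_sq (σ * t)
  · have hc : deriv (fun _ : ℝ => (1 : ℝ)) = fun _ => 0 := funext fun t => deriv_const t 1
    have hi : deriv (fun t : ℝ => t) = fun _ => 1 := funext fun t => deriv_id t
    have hexp : ∀ t : ℝ, t ≤ 0 → 1 ≤ Real.exp (-(1 / 2 * t)) := fun t ht =>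
      Real.one_le_exp (by linarith)
    refine ⟨fun _ => 1, fun t => t, 2, 1 / 2, 1, by norm_num, one_ne_zero, contDiff_const,
      contDiff_id, ?_, ?_, ?_, ?_, ?_⟩
    · intro t
      rw [hc, deriv_const, zero_mul]
    · intro t
      rw [hi, deriv_const, zero_mul]
    · intro t ht
      rw [abs_one]
      linarith [hexp t ht]
    · intro t ht
      rw [abs_of_nonpos ht]
      linarith [Real.add_one_le_exp (-(1 / 2 * t))]
    · intro t
      rw [hc, hi]
      ring
  · set σ := √D with hσ
    have hσ0 : 0 < σ := Real.sqrt_pos.2 h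
    have hσ2 : σ ^ 2 = D := Real.sq_sqrt h.le
    have hσ1 : σ < 1 := by nlinarith
    have d : ∀ s : ℝ, deriv (fun t => Real.exp (s * t)) = fun t => s * Real.exp (s * t) := by
      intro s
      funext t
      have := ((Real.hasDerivAt_exp (s * t)).comp t ((hasDerivAt_id t).const_mul s)).deriv
      refine this.trans ?_
      ring
    have hexp : ∀ s : ℝ, ContDiff ℝ ∞ fun t => Real.exp (s * t) := fun s =>
      Real.contDiff_exp.comp (contDiff_const.mul contDiff_id)
    refine ⟨fun t => Real.exp (σ * t), fun t => Real.exp (-σ * t), 1, σ, -2 * σ, hσ1, by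
      simpa using hσ0.ne', hexp _, hexp _, ?_, ?_, ?_, ?_, ?_⟩
    · intro t
      rw [d, deriv_const_mul_field, d]
      simp only
      linear_combination Real.exp (σ * t) * hσ2
    · intro t
      rw [d, deriv_const_mul_field, d]
      simp only
      linear_combination Real.exp (-σ * t) * hσ2
    · intro t ht
      rw [abs_of_pos (Real.exp_pos _), one_mul, Real.exp_le_exp]
      nlinarith
    · intro t ht
      rw [abs_of_pos (Real.exp_pos _), one_mul, Real.exp_le_exp, neg_mul]
    · intro t
      rw [d, d]
      simp only
      have : Real.exp (σ * t) * Real.exp (-σ * t) = 1 := by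
        rw [← Real.exp_add]
        simp
      linear_combination (-2 * σ) * this

/-- The function `x^{(1+α)/2} ψ(log x)`, cut off near infinity. -/
def cutoffSolution (α : ℝ) (ψ : ℝ → ℝ) (x : ℝ) : ℝ :=
  Real.smoothTransition (2 - x) * (x ^ ((1 + α) / 2) * ψ (Real.log x))

theorem contDiffOn_cutoffSolution (α : ℝ) {ψ : ℝ → ℝ} (hψ : ContDiff ℝ ∞ ψ) :
    ContDiffOn ℝ ∞ (cutoffSolution α ψ) (Ioi 0) := by
  have h1 : ContDiff ℝ ∞ fun x : ℝ => Real.smoothTransition (2 - x) :=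
    Real.smoothTransition.contDiff.comp (contDiff_const.sub contDiff_id)
  refine h1.contDiffOn.mul (ContDiffOn.mul ?_ (hψ.comp_contDiffOn ?_))
  · exact fun x hx => (Real.contDiffAt_rpow_const_of_ne (ne_of_gt hx)).contDiffWithinAt
  · exact fun x hx => (Real.contDiffAt_log.2 (ne_of_gt hx)).contDiffWithinAt

theorem cutoffSolution_eq_zero (α : ℝ) (ψ : ℝ → ℝ) {x : ℝ} (hx : 2 ≤ x) :
    cutoffSolution α ψ x = 0 := by
  rw [cutoffSolution, Real.smoothTransition.zero_of_nonpos (by linarith), zero_mul]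

theorem cutoffSolution_eq (α : ℝ) (ψ : ℝ → ℝ) {x : ℝ} (hx : x ≤ 1) :
    cutoffSolution α ψ x = x ^ ((1 + α) / 2) * ψ (Real.log x) := by
  rw [cutoffSolution, Real.smoothTransition.one_of_one_le (by linarith), one_mul]

theorem deriv_cutoffSolution (α : ℝ) {ψ : ℝ → ℝ} (hψ : ContDiff ℝ ∞ ψ) {x : ℝ} (hx : 0 < x)
    (hx1 : x < 1) : deriv (cutoffSolution α ψ) x = x ^ ((1 + α) / 2 - 1) *
      ((1 + α) / 2 * ψ (Real.log x) + deriv ψ (Real.log x)) := by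
  have h : cutoffSolution α ψ =ᶠ[𝓝 x] fun x => x ^ ((1 + α) / 2) * ψ (Real.log x) := by
    filter_upwards [Iio_mem_nhds hx1] with y hy using cutoffSolution_eq α ψ (le_of_lt hy)
  rw [h.deriv_eq]
  have h1 : HasDerivAt ψ (deriv ψ (Real.log x)) (Real.log x) :=
    (hψ.differentiable (by simp) _).hasDerivAt
  refine ((Real.hasDerivAt_rpow_const (p := (1 + α) / 2) (Or.inl hx.ne')).mul
    (h1.comp x (Real.hasDerivAt_log hx.ne'))).deriv.trans ?_
  rw [Real.rpow_sub hx, Real.rpow_one]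
  simp only [Function.comp_apply]
  field_simp

/-- The radial equation is of Euler type. In the variable t = log x, the factor x^{(1+α)/2} removes
the first-order term and leaves ψ'' = Dψ. -/
theorem radialExpr_cutoffSolution (α c : ℝ) {ψ : ℝ → ℝ} (hψ : ContDiff ℝ ∞ ψ)
    (hD : ∀ t, deriv (deriv ψ) t = ((1 + α) ^ 2 / 4 - c * (α * (α + 1))) * ψ t) {x : ℝ}
    (hx : 0 < x) (hx1 : x < 1) : radialExpr α c (cutoffSolution α ψ) x = 0 := by
  have h : deriv (cutoffSolution α ψ) =ᶠ[𝓝 x] fun x => x ^ ((1 + α) / 2 - 1) *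
      ((1 + α) / 2 * ψ (Real.log x) + deriv ψ (Real.log x)) := by
    filter_upwards [Iio_mem_nhds hx1, Ioi_mem_nhds hx] with y hy hy0
      using deriv_cutoffSolution α hψ hy0 hy
  have hψ' : ContDiff ℝ ∞ (deriv ψ) := (contDiff_infty_iff_deriv.1 hψ).2
  have h1 : HasDerivAt (fun x => ψ (Real.log x)) (deriv ψ (Real.log x) * x⁻¹) x :=
    HasDerivAt.comp x (hψ.differentiable (by simp) _).hasDerivAt (Real.hasDerivAt_log hx.ne')
  have h2 : HasDerivAt (fun x => deriv ψ (Real.log x)) (deriv (deriv ψ) (Real.log x) * x⁻¹) x :=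
    HasDerivAt.comp x (hψ'.differentiable (by simp) _).hasDerivAt (Real.hasDerivAt_log hx.ne')
  have h3 := ((Real.hasDerivAt_rpow_const (p := (1 + α) / 2 - 1) (Or.inl hx.ne')).mul
    ((h1.const_mul ((1 + α) / 2)).add h2)).deriv
  have h4 := h.deriv_eq.trans h3
  rw [radialExpr, h4, deriv_cutoffSolution α hψ hx hx1, cutoffSolution_eq α ψ hx1.le, hD,
    Real.rpow_sub hx ((1 + α) / 2 - 1), Real.rpow_sub hx ((1 + α) / 2), Real.rpow_one]
  simp only [Pi.add_apply]
  field_simp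
  ring

theorem radialExpr_cutoffSolution_eq_zero (α c : ℝ) (ψ : ℝ → ℝ) {x : ℝ} (hx : 2 < x) :
    radialExpr α c (cutoffSolution α ψ) x = 0 := by
  have h : cutoffSolution α ψ =ᶠ[𝓝 x] fun _ => 0 := by
    filter_upwards [Ioi_mem_nhds hx] with y hy using cutoffSolution_eq_zero α ψ (le_of_lt hy)
  have h' : deriv (cutoffSolution α ψ) =ᶠ[𝓝 x] fun _ => 0 := by
    refine h.deriv.trans (Eventually.of_forall fun y => deriv_const y 0)
  rw [radialExpr, h'.deriv_eq, h'.eq_of_nhds, h.eq_of_nhds]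
  simp

theorem integrableOn_Ioi_of_continuousOn {F : ℝ → ℝ} (hF : ContinuousOn F (Ioi 0)) {a b : ℝ}
    (ha : 0 < a) (h : ∀ x, 0 < x → x ∉ Icc a b → F x = 0) : IntegrableOn F (Ioi 0) :=
  IntegrableOn.of_forall_sdiff_eq_zero
    ((hF.mono fun _ hx => ha.trans_le hx.1).integrableOn_compact isCompact_Icc) measurableSet_Ioi
    fun x hx => h x hx.1 hx.2

/-- Near 0 the bound reads |ψ(log x)| ≤ K x^{-θ}, so the integrand is at most K² x^{1-2θ},
integrable precisely because θ < 1. -/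
theorem integrableOn_sq_cutoffSolution (α : ℝ) {ψ : ℝ → ℝ} (hψ : ContDiff ℝ ∞ ψ) {K θ : ℝ}
    (hθ : θ < 1) (hK : ∀ t ≤ 0, |ψ t| ≤ K * Real.exp (-(θ * t))) :
    IntegrableOn (fun x => x ^ (-α) * cutoffSolution α ψ x ^ 2) (Ioi 0) := by
  have hc : ContinuousOn (fun x => x ^ (-α) * cutoffSolution α ψ x ^ 2) (Ioi 0) :=
    (continuousOn_id.rpow_const fun x hx => Or.inl (ne_of_gt hx)).mul
      ((contDiffOn_cutoffSolution α hψ).continuousOn.pow 2)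
  have h1 : IntegrableOn (fun x => x ^ (-α) * cutoffSolution α ψ x ^ 2) (Ioc 0 1) := by
    have h2 : IntegrableOn (fun x : ℝ => K ^ 2 * x ^ (1 - 2 * θ)) (Ioc 0 1) := by
      have := (intervalIntegral.intervalIntegrable_rpow' (a := 0) (b := 1)
        (show -1 < 1 - 2 * θ by linarith)).const_mul (K ^ 2)
      exact (intervalIntegrable_iff_integrableOn_Ioc_of_le zero_le_one).1 this
    refine h2.mono' ((hc.mono fun x hx => hx.1).aestronglyMeasurable measurableSet_Ioc) ?_
    refine (ae_restrict_iff' measurableSet_Ioc).2 (Eventually.of_forall fun x hx => ?_)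
    have hx0 : 0 < x := hx.1
    rw [Real.norm_of_nonneg (mul_nonneg (Real.rpow_nonneg hx0.le _) (sq_nonneg _)),
      cutoffSolution_eq α ψ hx.2]
    have h3 := hK _ (Real.log_nonpos hx0.le hx.2)
    have h4 : Real.exp (-(θ * Real.log x)) = x ^ (-θ) := by
      rw [Real.rpow_def_of_pos hx0]
      congr 1
      ring
    rw [h4] at h3
    have h5 : ψ (Real.log x) ^ 2 ≤ K ^ 2 * (x ^ (-θ)) ^ 2 := by
      rw [← sq_abs, ← mul_pow]
      exact pow_le_pow_left₀ (abs_nonneg _) h3 2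
    have h6 : x ^ (1 - 2 * θ) = x ^ (-α) * (x ^ ((1 + α) / 2)) ^ 2 * (x ^ (-θ)) ^ 2 := by
      rw [← Real.rpow_natCast, ← Real.rpow_natCast, ← Real.rpow_mul hx0.le,
        ← Real.rpow_mul hx0.le, ← Real.rpow_add hx0, ← Real.rpow_add hx0]
      congr 1
      push_cast
      ring
    rw [h6]
    have h7 : 0 ≤ x ^ (-α) * (x ^ ((1 + α) / 2)) ^ 2 :=
      mul_nonneg (Real.rpow_nonneg hx0.le _) (sq_nonneg _)
    calc x ^ (-α) * (x ^ ((1 + α) / 2) * ψ (Real.log x)) ^ 2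
        = x ^ (-α) * (x ^ ((1 + α) / 2)) ^ 2 * ψ (Real.log x) ^ 2 := by ring
      _ ≤ x ^ (-α) * (x ^ ((1 + α) / 2)) ^ 2 * (K ^ 2 * (x ^ (-θ)) ^ 2) :=
        mul_le_mul_of_nonneg_left h5 h7
      _ = _ := by ring
  have h8 : IntegrableOn (fun x => x ^ (-α) * cutoffSolution α ψ x ^ 2) (Icc 1 2) :=
    (hc.mono fun x hx => one_pos.trans_le hx.1).integrableOn_compact isCompact_Icc
  refine IntegrableOn.of_forall_sdiff_eq_zero (h1.union h8) measurableSet_Ioi fun x hx => ?_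
  have hx2 : 2 ≤ x := by
    by_contra h9
    rcases le_or_gt x 1 with h10 | h10
    · exact hx.2 (Or.inl ⟨hx.1, h10⟩)
    · exact hx.2 (Or.inr ⟨h10.le, (not_le.1 h9).le⟩)
  rw [cutoffSolution_eq_zero α ψ hx2]
  simp

/-- The cut-off solutions are annihilated by the operator outside [1, 2]. By Lagrange's identity
their boundary form is minus the weighted Wronskian at a point below 1, that is, -b ≠ 0, whereas
self-adjointness would make it zero. -/
theorem not_isEssentiallySelfAdjoint {α c : ℝ} (h : (1 + α) ^ 2 / 4 - c * (α * (α + 1)) < 1) :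
    ¬ IsEssentiallySelfAdjoint (curvatureLaplacian α c) := by
  intro hs
  obtain ⟨ψ₁, ψ₂, K, θ, b, hθ, hb, h1, h2, hD1, hD2, hK1, hK2, hw⟩ := exists_fundamental_system h
  set U := cutoffSolution α ψ₁ with hUdef
  set V := cutoffSolution α ψ₂ with hVdef
  have hU : ContDiffOn ℝ ∞ U (Ioi 0) := contDiffOn_cutoffSolution α h1
  have hV : ContDiffOn ℝ ∞ V (Ioi 0) := contDiffOn_cutoffSolution α h2
  have hrp : ContinuousOn (fun x : ℝ => x ^ (-α)) (Ioi 0) :=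
    continuousOn_id.rpow_const fun x hx => Or.inl (ne_of_gt hx)
  have hzero : ∀ {ψ : ℝ → ℝ}, ContDiff ℝ ∞ ψ →
      (∀ t, deriv (deriv ψ) t = ((1 + α) ^ 2 / 4 - c * (α * (α + 1))) * ψ t) → ∀ x, 0 < x →
      x ∉ Icc 1 2 → radialExpr α c (cutoffSolution α ψ) x = 0 := by
    intro ψ hψ hD x hx hx2
    rcases lt_or_ge x 1 with h3 | h3
    · exact radialExpr_cutoffSolution α c hψ hD hx h3
    · exact radialExpr_cutoffSolution_eq_zero α c ψ (not_le.1 fun h4 => hx2 ⟨h3, h4⟩)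
  have hLi : ∀ {ψ : ℝ → ℝ}, ContDiff ℝ ∞ ψ →
      (∀ t, deriv (deriv ψ) t = ((1 + α) ^ 2 / 4 - c * (α * (α + 1))) * ψ t) →
      IntegrableOn (fun x => x ^ (-α) * radialExpr α c (cutoffSolution α ψ) x ^ 2) (Ioi 0) :=
    fun hψ hD => integrableOn_Ioi_of_continuousOn
      (hrp.mul ((continuousOn_radialExpr α c (contDiffOn_cutoffSolution α hψ)).pow 2)) one_pos
      fun x hx hx2 => by rw [hzero hψ hD x hx hx2]; simp
  have hform := boundary_form_eq_zero hs hU hV (integrableOn_sq_cutoffSolution α h1 hθ hK1)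
    (integrableOn_sq_cutoffSolution α h2 hθ hK2) (hLi h1 hD1) (hLi h2 hD2)
  have hFc : ContinuousOn
      (fun x => x ^ (-α) * (radialExpr α c U x * V x - U x * radialExpr α c V x)) (Ioi 0) :=
    hrp.mul (((continuousOn_radialExpr α c hU).mul hV.continuousOn).sub (hU.continuousOn.mul (continuousOn_radialExpr α c hV)))
  -- The endpoints 1/2 < 1 and 3 > 2 avoid the cut-off region: at 1/2 the exact solutions are seen,
  -- and at 3 both functions vanish.
  have hsub : Icc (1 / 2 : ℝ) 3 ⊆ Ioi 0 := fun x hx =>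
    lt_of_lt_of_le (by norm_num : (0 : ℝ) < 1 / 2) hx.1
  have hred : ∫ x in Ioi 0, x ^ (-α) * (radialExpr α c U x * V x - U x * radialExpr α c V x)
      = ∫ x in (1 / 2 : ℝ)..3,
        x ^ (-α) * (radialExpr α c U x * V x - U x * radialExpr α c V x) := by
    rw [intervalIntegral.integral_of_le (by norm_num), ← integral_Icc_eq_integral_Ioc]
    refine setIntegral_eq_of_subset_of_forall_sdiff_eq_zero measurableSet_Ioi hsub
      fun x hx => ?_
    have hx2 : x ∉ Icc (1 : ℝ) 2 := fun h3 => hx.2 ⟨by linarith [h3.1], by linarith [h3.2]⟩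
    rw [hUdef, hVdef, hzero h1 hD1 x hx.1 hx2, hzero h2 hD2 x hx.1 hx2]
    simp
  rw [hred, intervalIntegral.integral_eq_sub_of_hasDerivAt
    (f := fun x => x ^ (-α) * (U x * deriv V x - deriv U x * V x))] at hform
  · have hx : (0 : ℝ) < 1 / 2 := by norm_num
    have hx1 : (1 / 2 : ℝ) < 1 := by norm_num
    have e1 : (1 / 2 : ℝ) ^ (-α) * (U (1 / 2) * deriv V (1 / 2) - deriv U (1 / 2) * V (1 / 2))
        = b := by
      rw [hUdef, hVdef, deriv_cutoffSolution α h1 hx hx1, deriv_cutoffSolution α h2 hx hx1,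
        cutoffSolution_eq α ψ₁ hx1.le, cutoffSolution_eq α ψ₂ hx1.le, ← hw (Real.log (1 / 2))]
      -- The powers of x cancel, so the weighted Wronskian in x equals that of ψ₁, ψ₂ in t.
      have e2 : (1 / 2 : ℝ) ^ (-α) * ((1 / 2 : ℝ) ^ ((1 + α) / 2) * (1 / 2) ^ ((1 + α) / 2 - 1))
          = 1 := by
        rw [← Real.rpow_add hx, ← Real.rpow_add hx]
        have : -α + ((1 + α) / 2 + ((1 + α) / 2 - 1)) = 0 := by ring
        rw [this, Real.rpow_zero]
      linear_combination (ψ₁ (Real.log (1 / 2)) * deriv ψ₂ (Real.log (1 / 2))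
        - deriv ψ₁ (Real.log (1 / 2)) * ψ₂ (Real.log (1 / 2))) * e2
    have e3 : U 3 = 0 := cutoffSolution_eq_zero α ψ₁ (by norm_num)
    have e4 : V 3 = 0 := cutoffSolution_eq_zero α ψ₂ (by norm_num)
    simp only [e1, e3, e4, mul_zero, zero_mul, sub_zero, zero_sub, neg_eq_zero] at hform
    exact hb hform
  · intro x hx
    rw [uIcc_of_le (by norm_num)] at hx
    exact hasDerivAt_boundary α c hU hV (hsub hx)
  · refine (hFc.mono ?_).intervalIntegrable
    rw [uIcc_of_le (by norm_num)]
    exact hsub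

/-- The two criteria are complementary: D = m + 1/4, so D < 1 means m < 3/4, and the quadratic is 4m
- 3. -/
theorem isEssentiallySelfAdjoint_iff (α c : ℝ) :
    IsEssentiallySelfAdjoint (curvatureLaplacian α c) ↔
      0 ≤ (1 - 4 * c) * α ^ 2 + (2 - 4 * c) * α - 3 := by
  refine ⟨fun h => ?_, fun h => isEssentiallySelfAdjoint_of_le (by nlinarith)⟩
  by_contra hn
  exact not_isEssentiallySelfAdjoint (by nlinarith) h

/-! ### The roots of the quadratic condition -/

/-- The product under the root is c² - 4c + 1, a sixteenth of the discriminant. The denominator 4c -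
1 is cleared before comparing. -/
theorem quadratic_eq {c : ℝ} (hc : 4 * c - 1 ≠ 0)
    (h : 0 ≤ (c - 2 + √3) * (c - 2 - √3)) (α : ℝ) :
    (1 - 4 * c) * α ^ 2 + (2 - 4 * c) * α - 3 =
      (1 - 4 * c) * ((α - alphaPlus c) * (α - alphaMinus c)) := by
  have h3 : √3 ^ 2 = 3 := Real.sq_sqrt (by norm_num)
  set r := √((c - 2 + √3) * (c - 2 - √3)) with hr
  have hr2 : r ^ 2 = c ^ 2 - 4 * c + 1 := by
    rw [hr, Real.sq_sqrt h]
    linear_combination -h3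
  have e1 : (4 * c - 1) * alphaPlus c = (-2 * c + 1) + 2 * r := by
    rw [alphaPlus, ← hr]
    field_simp
  have e2 : (4 * c - 1) * alphaMinus c = (-2 * c + 1) - 2 * r := by
    rw [alphaMinus, ← hr]
    field_simp
  apply mul_left_cancel₀ hc
  linear_combination (-(4 * c - 1) * α + (4 * c - 1) * alphaMinus c) * e1
    + (-(4 * c - 1) * α + (-2 * c + 1) + 2 * r) * e2 - 4 * hr2

theorem discriminant_nonneg_of_le {c : ℝ} (h : c ≤ 2 - √3) :
    0 ≤ (c - 2 + √3) * (c - 2 - √3) :=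
  mul_nonneg_of_nonpos_of_nonpos (by linarith) (by linarith [Real.sqrt_nonneg 3])

theorem discriminant_nonneg_of_ge {c : ℝ} (h : 2 + √3 ≤ c) :
    0 ≤ (c - 2 + √3) * (c - 2 - √3) :=
  mul_nonneg (by linarith [Real.sqrt_nonneg 3]) (by linarith)

theorem alphaMinus_le_alphaPlus {c : ℝ} (hc : 1 / 4 < c) : alphaMinus c ≤ alphaPlus c :=
  div_le_div_of_nonneg_right (by linarith [Real.sqrt_nonneg ((c - 2 + √3) * (c - 2 - √3))])
    (by linarith)

theorem alphaPlus_le_alphaMinus {c : ℝ} (hc : c < 1 / 4) : alphaPlus c ≤ alphaMinus c :=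
  div_le_div_of_nonpos_of_le (by linarith)
    (by linarith [Real.sqrt_nonneg ((c - 2 + √3) * (c - 2 - √3))])

/-- Equivalent to 1/4 < 2 - √3: for c ≤ 1/4 the discriminant is nonnegative, and above 2 - √3 the
leading coefficient 1 - 4c is negative. -/
theorem sqrt_three_lt : √3 < 7 / 4 := by
  rw [Real.sqrt_lt' (by norm_num)]
  norm_num

theorem quadratic_nonneg_iff_of_gt {c : ℝ} (hc : 1 / 4 < c)
    (h : 0 ≤ (c - 2 + √3) * (c - 2 - √3)) (α : ℝ) :
    0 ≤ (1 - 4 * c) * α ^ 2 + (2 - 4 * c) * α - 3 ↔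
      alphaMinus c ≤ α ∧ α ≤ alphaPlus c := by
  rw [quadratic_eq (by linarith) h]
  have hle := alphaMinus_le_alphaPlus hc
  constructor
  · intro hq
    have hp : (α - alphaPlus c) * (α - alphaMinus c) ≤ 0 := by nlinarith
    constructor <;> by_contra hn <;> nlinarith
  · rintro ⟨h1, h2⟩
    exact mul_nonneg_of_nonpos_of_nonpos (by linarith)
      (mul_nonpos_of_nonpos_of_nonneg (by linarith) (by linarith))

theorem quadratic_nonneg_iff_of_lt {c : ℝ} (hc : c < 1 / 4) (α : ℝ) :
    0 ≤ (1 - 4 * c) * α ^ 2 + (2 - 4 * c) * α - 3 ↔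
      α ≤ alphaPlus c ∨ alphaMinus c ≤ α := by
  rw [quadratic_eq (by linarith) (discriminant_nonneg_of_le (by linarith [sqrt_three_lt]))]
  have hle := alphaPlus_le_alphaMinus hc
  constructor
  · intro hq
    by_contra hn
    rw [not_or, not_le, not_le] at hn
    have := mul_pos (sub_pos.2 hn.1) (sub_pos.2 hn.2)
    nlinarith
  · rintro (h1 | h1)
    · exact mul_nonneg (by linarith)
        (mul_nonneg_of_nonpos_of_nonpos (by linarith) (by linarith))
    · exact mul_nonneg (by linarith) (mul_nonneg (by linarith) (by linarith))

theorem quadratic_neg {c : ℝ} (h1 : 2 - √3 < c) (h2 : c < 2 + √3) (α : ℝ) :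
    (1 - 4 * c) * α ^ 2 + (2 - 4 * c) * α - 3 < 0 := by
  have h3 : √3 ^ 2 = 3 := Real.sq_sqrt (by norm_num)
  have hc : 0 < 4 * c - 1 := by linarith [sqrt_three_lt]
  have hd : c ^ 2 - 4 * c + 1 < 0 := by
    nlinarith [mul_pos (sub_pos.2 h1) (sub_pos.2 h2)]
  -- Completing the square, the product equals -((4c-1)α - (1-2c))² + 4(c² - 4c + 1).
  have h4 : (4 * c - 1) * ((1 - 4 * c) * α ^ 2 + (2 - 4 * c) * α - 3) < 0 := by
    nlinarith [sq_nonneg ((4 * c - 1) * α - (1 - 2 * c))]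
  by_contra hn
  exact absurd h4 (not_lt.2 (mul_nonneg hc.le (not_lt.1 hn)))

end GrushinCylinder

end

theorem proposition1p4 (α c : ℝ) (hc : 0 ≤ c) :
    (c < 1 / 4 →
      (GrushinCylinder.IsEssentiallySelfAdjoint (GrushinCylinder.curvatureLaplacian α c) ↔
        α ≤ GrushinCylinder.alphaPlus c ∨ GrushinCylinder.alphaMinus c ≤ α)) ∧
    (c = 1 / 4 →
      (GrushinCylinder.IsEssentiallySelfAdjoint (GrushinCylinder.curvatureLaplacian α c) ↔
        3 ≤ α)) ∧
    (1 / 4 < c → c ≤ 2 - √3 →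
      (GrushinCylinder.IsEssentiallySelfAdjoint (GrushinCylinder.curvatureLaplacian α c) ↔
        GrushinCylinder.alphaMinus c ≤ α ∧ α ≤ GrushinCylinder.alphaPlus c)) ∧
    (2 - √3 < c → c < 2 + √3 →
      ¬ GrushinCylinder.IsEssentiallySelfAdjoint (GrushinCylinder.curvatureLaplacian α c)) ∧
    (2 + √3 ≤ c →
      (GrushinCylinder.IsEssentiallySelfAdjoint (GrushinCylinder.curvatureLaplacian α c) ↔
        GrushinCylinder.alphaMinus c ≤ α ∧ α ≤ GrushinCylinder.alphaPlus c)) ∧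
    (α = 1 →
      (GrushinCylinder.IsEssentiallySelfAdjoint (GrushinCylinder.curvatureLaplacian α c) ↔
        c = 0)) := by
  rw [GrushinCylinder.isEssentiallySelfAdjoint_iff]
  refine ⟨fun h => GrushinCylinder.quadratic_nonneg_iff_of_lt h α, ?_,
    fun h1 h2 => GrushinCylinder.quadratic_nonneg_iff_of_gt h1
      (GrushinCylinder.discriminant_nonneg_of_le h2) α,
    fun h1 h2 => not_le.2 (GrushinCylinder.quadratic_neg h1 h2 α),
    fun h => GrushinCylinder.quadratic_nonneg_iff_of_gt
      (by linarith [Real.sqrt_nonneg 3]) (GrushinCylinder.discriminant_nonneg_of_ge h) α, ?_⟩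
  -- At c = 1/4 the quadratic degenerates to α - 3.
  · rintro rfl
    constructor <;> intro h <;> linarith
  -- At α = 1 the quadratic is -8c.
  · rintro rfl
    constructor <;> intro h <;> linarith
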